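/- Equip $\mathbb{R}^{d,1}=\mathbb{R}^{d+1}$ with the Lorentzian product $x\circ y=x_1y_1+\dots+x_dy_d-x_{d+1}y_{d+1}$ and let $\mathbb{H}^d=\{x : x\circ x=-1,\ x_{d+1}>0\}$. A convex polytope of dimension $d$ in $\mathbb{H}^d$ is an intersection of finitely many closed half-spaces $\{x\in\mathbb{H}^d : x\circ e\le 0\}$ (with $e\circ e=1$) that contains a nonempty open subset of $\mathbb{H}^d$. It is a Coxeter polytope if any two of its bounding hyperplanes (the hyperplanes spanned by its facets) which intersect in $\mathbb{H}^d$ form a dihedral angle $\pi/m$ with an integer $m\ge 2$. Its growth function is the growth series $\sum_{k\ge0}a_kt^k$ of the group generated by the reflections in its bounding hyperplanes, where $a_k$ is the number of elements of word length $k$ with respect to these reflections. A facet of a polytope is regarded as a polytope in the hyperbolic subspace that it spans, and has a growth function in the same way. Let $e_1,\dots,e_5\in\mathbb{R}^{4,1}$ be the outward unit normals of a polytope $S\subset\mathbb{H}^4$ with Gram matrix $$G=(e_i\circ e_j)=\begin{pmatrix} 1&-\cos\frac{\pi}{5}&0&-\frac12&0\\ -\cos\frac{\pi}{5}&1&-\frac12&0&-\frac12\\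 0&-\frac12&1&-\cos\frac{\pi}{5}&0\\ -\frac12&0&-\cos\frac{\pi}{5}&1&-\frac12\\ 0&-\frac12&0&-\frac12&1\end{pmatrix}$$ (such a polytope exists and is unique up to isometry). For $i=1,\dots,5$ put $w_i=\sum_k \mathrm{cof}_{ik}(G)\,e_k$ and $v_i=w_i/\sqrt{\mathrm{cof}_{ii}(G)\det G}$, so that $v_i\circ v_i=1$, $v_i\circ e_j=0$ for $j\ne i$, and $v_i\circ e_i<0$. Let $$T=\{x\in S : x\circ v_i\le 0 \text{ for } i=1,\dots,5\},\qquad F_i=\{x\in T : x\circ v_i=0\}.$$ $T$ is a Coxeter polytope, and $F_1,\dots,F_5$ are called its orthogonal facets. $F_1$ and $F_3$ are of type $A$, $F_2$ and $F_4$ are of type $B$, and $F_5$ is of type $C$; orthogonal facets of the same type are isometric. Let $W(t),A(t),B(t),C(t)$ be the growth functions of $T$ and of the orthogonal facets of types $A$, $B$, $C$. Isometric images of $T$ are called copies of $T$. Two polytopes $P_1,P_2$, each of which is a copy of $T$ or has been obtained from copies of $T$ by such gluings, are glued along an orthogonal facet of type $X\in\{A,B,C\}$ if they are placed in $\mathbb{H}^4$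 so that $P_1\cap P_2=F$, where $F$ is an orthogonal facet of type $X$ of a copy in $P_1$ and also of a copy in $P_2$, along which nothing has been glued before; the result is $P_1\cup P_2$. Let $\ell,m,n\ge 0$ be integers with $\ell+m\le n$, and let $P\subset\mathbb{H}^4$ be obtained from $n+1$ copies of $T$ by $n$ gluings, of which $\ell$ are along orthogonal facets of type $A$, $m$ along type $B$ and $n-\ell-m$ along type $C$. Then $P$ is a Coxeter polytope; moreover $n-\ell-m\le (n+1)/2$ if $n$ is odd and $n-\ell-m\le n/2$ if $n$ is even; and the growth function $W_{\ell,m,n}(t)$ of $P$ satisfies $$\frac{1}{W_{\ell,m,n}(t)}=\frac{n+1}{W(t)}+\frac{t-1}{t+1}\left(\frac{\ell}{A(t)}+\frac{m}{B(t)}+\frac{n-\ell-m}{C(t)}\right)$$ as an identity of formal power series in $\mathbb{Q}[[t]]$. -/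

import Mathlib

open scoped PowerSeries

noncomputable section

namespace CoxeterDomino

/-! ### Hyperbolic space in the hyperboloid model -/

/-- The vector space `ℝ^{d+1}` underlying Lorentzian space `ℝ^{d,1}`. -/
abbrev Mink (d : ℕ) : Type := Fin (d + 1) → ℝ

/-- The Lorentzian inner product `x₁y₁ + ⋯ + x_d y_d - x_{d+1}y_{d+1}`. -/
def lorentz {d : ℕ} (x y : Mink d) : ℝ :=
  (∑ i : Fin d, x i.castSucc * y i.castSucc) - x (Fin.last d) * y (Fin.last d)

/-- Hyperbolic `d`-space. -/
def hyperbolicSpace (d : ℕ) : Set (Mink d) :=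
  {x | lorentz x x = -1 ∧ 0 < x (Fin.last d)}

/-- Isometries of hyperbolic `d`-space, as linear maps of Lorentzian space that preserve the
inner product and the upper sheet of the hyperboloid. -/
def IsHypIsometry {d : ℕ} (g : Mink d ≃ₗ[ℝ] Mink d) : Prop :=
  (∀ x y, lorentz (g x) (g y) = lorentz x y) ∧
    ∀ x ∈ hyperbolicSpace d, g x ∈ hyperbolicSpace d

/-- The intersection with `H^d` of the half spaces with outward normals `e i`. -/
def halfSpaces {d : ℕ} {ι : Type} (e : ι → Mink d) : Set (Mink d) :=
  {x | x ∈ hyperbolicSpace d ∧ ∀ i, lorentz x (e i) ≤ 0}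

/-- A convex polytope of dimension `d` in `H^d`: the intersection of finitely many closed half
spaces, containing a nonempty open subset of `H^d`. -/
def IsPolytope {d : ℕ} (P : Set (Mink d)) : Prop :=
  (∃ (k : ℕ) (e : Fin k → Mink d), (∀ i, lorentz (e i) (e i) = 1) ∧ P = halfSpaces e) ∧
    ∃ U : Set (Mink d), IsOpen U ∧ (U ∩ hyperbolicSpace d).Nonempty ∧
      U ∩ hyperbolicSpace d ⊆ P

/-- The outward unit normals of the facets (faces of codimension one) of a convex polytope `P`
which is full-dimensional in the hyperbolic subspace `span P ∩ H^d` that it spans.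
A nonempty convex polytope of dimension `k` spans a linear subspace of dimension `k + 1`.
If `P` is full-dimensional in `H^d`, then `span P` is the whole space; the general case lets
faces of polytopes be considered as polytopes themselves. -/
def facetNormals {d : ℕ} (P : Set (Mink d)) : Set (Mink d) :=
  {e | e ∈ Submodule.span ℝ P ∧ lorentz e e = 1 ∧ (∀ x ∈ P, lorentz x e ≤ 0) ∧
    Module.finrank ℝ (Submodule.span ℝ {x | x ∈ P ∧ lorentz x e = 0}) + 1 =
      Module.finrank ℝ (Submodule.span ℝ P)}

/-- A Coxeter polytope in `H^d`: whenever two of its bounding hyperplanes intersect in `H^d`,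
the dihedral angle between them is `π / m` for some integer `m ≥ 2`. -/
def IsCoxeterPolytope {d : ℕ} (P : Set (Mink d)) : Prop :=
  IsPolytope P ∧
    ∀ e ∈ facetNormals P, ∀ e' ∈ facetNormals P, e ≠ e' →
      (∃ x ∈ hyperbolicSpace d, lorentz x e = 0 ∧ lorentz x e' = 0) →
        ∃ m : ℕ, 2 ≤ m ∧ -lorentz e e' = Real.cos (Real.pi / m)

/-- The reflections in the hyperplanes bounding `P`. (For a lower-dimensional `P` these fix the
orthogonal complement of `span P` pointwise and act on `span P` as the reflections in the
hyperplanes of `span P ∩ H^d` bounding `P`.) -/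
def facetReflections {d : ℕ} (P : Set (Mink d)) : Set (Mink d ≃ₗ[ℝ] Mink d) :=
  {r | ∃ e ∈ facetNormals P, ∀ x, r x = x - (2 * lorentz x e) • e}

/-! ### Growth series -/

/-- `HasWordLength S g k`: the element `g` is a product of `k` elements of `S`, and of no smaller
number of them. -/
def HasWordLength {G : Type} [Group G] (S : Set G) (g : G) (k : ℕ) : Prop :=
  IsLeast {j : ℕ | ∃ w : List G, (∀ s ∈ w, s ∈ S) ∧ w.length = j ∧ w.prod = g} k

/-- The growth series `∑ a_k t^k` with respect to `S`, where `a_k` is the number of elements of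
word length `k`. It is used for sets `S` of involutions, for which the elements that have a word
length are those of the group generated by `S`. -/
def growthSeries {G : Type} [Group G] (S : Set G) : ℚ⟦X⟧ :=
  PowerSeries.mk fun k => (Nat.card {g : G // HasWordLength S g k} : ℚ)

/-- The growth function, as a power series, of the group generated by the reflections in the
hyperplanes bounding `P`, with respect to these reflections. -/
def polytopeGrowth {d : ℕ} (P : Set (Mink d)) : ℚ⟦X⟧ :=
  growthSeries (facetReflections P)

/-! ### The totally truncated simplex `T` -/

/-- The orders `m_{ij}` of the Coxeter graph of the underlying extended simplex. -/
def simplexOrder : Matrix (Fin 5) (Fin 5) ℕ :=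
  !![1, 5, 2, 3, 2;
     5, 1, 3, 2, 3;
     2, 3, 1, 5, 2;
     3, 2, 5, 1, 3;
     2, 3, 2, 3, 1]

/-- The Gram matrix `(-cos (π / m_{ij}))` of the underlying extended simplex. -/
def simplexGram : Matrix (Fin 5) (Fin 5) ℝ :=
  Matrix.of fun i j => -Real.cos (Real.pi / simplexOrder i j)

/-- `e` consists of the outward unit normals of a polytope in `H^4` with Gram matrix
`simplexGram`. (The polytope is unique up to isometry.) -/
def IsSimplexNormals (e : Fin 5 → Mink 4) : Prop :=
  (∀ i j, lorentz (e i) (e j) = simplexGram i j) ∧ IsPolytope (halfSpaces e)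

/-- The ultraideal vertex `v_i = w_i / √(w_i ∘ w_i)` opposite to the `i`-th facet, where
`w_i = ∑ₖ cof_{ik}(G) e_k` satisfies `w_i ∘ e_j = δ_{ij} det G` and
`w_i ∘ w_i = cof_{ii}(G) det G`. -/
def ultraidealVertex (e : Fin 5 → Mink 4) (i : Fin 5) : Mink 4 :=
  (Real.sqrt (simplexGram.adjugate i i * simplexGram.det))⁻¹ •
    ∑ k : Fin 5, simplexGram.adjugate k i • e k

/-- The Coxeter domino `T`: the simplex truncated at all its ultraideal vertices. -/
def domino (e : Fin 5 → Mink 4) : Set (Mink 4) :=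
  {x | x ∈ halfSpaces e ∧ ∀ i, lorentz x (ultraidealVertex e i) ≤ 0}

/-- The orthogonal facet of `T` that replaces the `i`-th ultraideal vertex. -/
def orthogonalFacet (e : Fin 5 → Mink 4) (i : Fin 5) : Set (Mink 4) :=
  {x | x ∈ domino e ∧ lorentz x (ultraidealVertex e i) = 0}

/-- The three types of orthogonal facets. -/
inductive FacetType : Type
  | A
  | B
  | C
  deriving DecidableEq

/-- The type of the `i`-th orthogonal facet, whose Coxeter graph is obtained by deleting the
`i`-th node: type `A` is the 4-cycle with exactly one label `5`, type `B` is the star with three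
edges, exactly one of them with label `5`, type `C` is the 4-cycle with labels `5, 3, 5, 3`. -/
def facetType : Fin 5 → FacetType :=
  ![FacetType.A, FacetType.B, FacetType.A, FacetType.B, FacetType.C]

/-! ### Gluing copies of `T` -/

/-- `IsGluing e P O N c`: the set `P` is obtained from `N` copies of `T` by successive gluing
along orthogonal facets of the same type, with `c Y` gluings along facets of type `Y`, and `O Y`
is the set of those orthogonal facets of type `Y` of the copies along which nothing has been
glued.

A copy of `T` is its image under an isometry. Two such polytopes `P₁` and `P₂` are glued along
`F` if they have been placed in `H^4` so that `F` is a free orthogonal facet of the same type of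
both and `P₁ ∩ P₂ = F`; the result is `P₁ ∪ P₂`. -/
inductive IsGluing (e : Fin 5 → Mink 4) :
    Set (Mink 4) → (FacetType → Set (Set (Mink 4))) → ℕ → (FacetType → ℕ) → Prop
  | copy (g : Mink 4 ≃ₗ[ℝ] Mink 4) (hg : IsHypIsometry g) :
      IsGluing e (g '' domino e)
        (fun Y => {F | ∃ i, facetType i = Y ∧ F = g '' orthogonalFacet e i}) 1 (fun _ => 0)
  | glue (P₁ P₂ : Set (Mink 4)) (O₁ O₂ : FacetType → Set (Set (Mink 4))) (N₁ N₂ : ℕ)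
      (c₁ c₂ : FacetType → ℕ) (X : FacetType) (F : Set (Mink 4))
      (h₁ : IsGluing e P₁ O₁ N₁ c₁) (h₂ : IsGluing e P₂ O₂ N₂ c₂)
      (hF₁ : F ∈ O₁ X) (hF₂ : F ∈ O₂ X) (hF : P₁ ∩ P₂ = F) :
      IsGluing e (P₁ ∪ P₂) (fun Y => (O₁ Y ∪ O₂ Y) \ {F}) (N₁ + N₂)
        (fun Y => c₁ Y + c₂ Y + if Y = X then 1 else 0)

end CoxeterDomino

end

/-! All the geometry is encoded in finite sets $E$ of outward unit normals. `IsRootBasis` asks that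
products of distinct normals are $-\cos(\pi/m)$ or at most $-1$, and that the chamber has an
interior point. Coxeter theory in terms of roots then applies: $w e$ is a nonnegative combination of
$E$ exactly when $w r_e$ is longer than $w$ (`IsRootBasis.apply_mem_cone`,
`IsRootBasis.hasWordLength_mul`). Hence for $J\subseteq E$ the elements that keep $J$ positive are
coset representatives with additive lengths, and the growth series factors as $W_E=M_J W_J$
(`IsRootBasis.rootGrowth_eq_mul`).

Let $E=E_1\cup E_2$, with products at most $-1$ between $E_1\setminus E_2$ and $E_2\setminus E_1$.
The complements of two such half-spaces are disjoint, so no group element makes both normals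
negative. Therefore $M_{E_1}+M_{E_2}=M_{E_1\cap E_2}+1$, and division by $W_E$ gives
$1/W_E+1/W_{E_1\cap E_2}=1/W_{E_1}+1/W_{E_2}$ (`IsRootBasis.inv_rootGrowth_union`).

This identity is used in two ways. Let $f$ be the normal of an orthogonal facet and $L$ the set of
normals perpendicular to $f$; all others have product at most $-1$ with $f$. First, $E$ is the
amalgam of $E\setminus\{f\}$ and $L\cup\{f\}$ over $L$, where $W_{L\cup\{f\}}=(1+t)W_L$; this gives
the effect of deleting $f$. Second, the polytope obtained by gluing along that facet has normals
$E_1\setminus\{f\}\cup E_2\setminus\{-f\}$, two sets that meet in $L$ and are otherwise separated by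
the hyperplane of $f$. Together they show that a gluing adds the reciprocals of the growth series
and contributes $\frac{t-1}{t+1}\frac1{W_L}$ (`IsMatching.inv_rootGrowth_glued`).

Since no dihedral angle is obtuse, every element of $E$ is the normal of a facet
(`facetNormals_chamberIn`). So a polytope or wall, given only as a set, determines its normals, and
the condition $P_1\cap P_2=F$ determines how the normals of the two sides match. For $T$, the
required inequalities are read off from the inverse of the Gram matrix. The formula follows by
induction over the gluings, keeping track of the pairwise disjointness of the hyperplanes of the
free facets. The bound on type $C$ is a count: each copy supplies at most one such facet and each
gluing uses up two. -/

noncomputable section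

namespace CoxeterDomino

/-! ### Word lengths -/

section Words

variable {G : Type} [Group G] {S S' : Set G} {g h : G} {j k : ℕ}

/-- The element `g` is a product of `k` elements of `S`. -/
def IsWordProd (S : Set G) (g : G) (k : ℕ) : Prop :=
  ∃ w : List G, (∀ s ∈ w, s ∈ S) ∧ w.length = k ∧ w.prod = g

lemma HasWordLength.isWordProd (hg : HasWordLength S g k) : IsWordProd S g k := hg.1

lemma HasWordLength.le (hg : HasWordLength S g k) (h : IsWordProd S g j) : k ≤ j := hg.2 h

lemma HasWordLength.unique (hg : HasWordLength S g k) (h : HasWordLength S g j) : k = j :=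
  le_antisymm (hg.le h.isWordProd) (h.le hg.isWordProd)

lemma IsWordProd.hasWordLength (hg : IsWordProd S g k) (h : ∀ j, IsWordProd S g j → k ≤ j) :
    HasWordLength S g k :=
  ⟨hg, fun _ hj => h _ hj⟩

lemma IsWordProd.exists_hasWordLength (hg : IsWordProd S g k) :
    ∃ j ≤ k, HasWordLength S g j := by
  classical
  have hex : ∃ j, IsWordProd S g j := ⟨k, hg⟩
  exact ⟨Nat.find hex, Nat.find_le hg, Nat.find_spec hex, fun _ hj => Nat.find_le hj⟩

lemma isWordProd_one : IsWordProd S (1 : G) 0 := ⟨[], by simp, rfl, rfl⟩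

lemma hasWordLength_one : HasWordLength S (1 : G) 0 :=
  isWordProd_one.hasWordLength fun _ _ => Nat.zero_le _

lemma isWordProd_zero : IsWordProd S g 0 ↔ g = 1 := by
  constructor
  · rintro ⟨w, -, hw, rfl⟩
    rw [List.length_eq_zero_iff.1 hw, List.prod_nil]
  · rintro rfl
    exact isWordProd_one

lemma isWordProd_of_mem (hg : g ∈ S) : IsWordProd S g 1 := ⟨[g], by simpa using hg, rfl, by simp⟩

lemma IsWordProd.mul (hg : IsWordProd S g j) (hh : IsWordProd S h k) :
    IsWordProd S (g * h) (j + k) := by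
  obtain ⟨w, hw, rfl, rfl⟩ := hg
  obtain ⟨w', hw', rfl, rfl⟩ := hh
  refine ⟨w ++ w', fun s hs => ?_, by simp, by simp⟩
  rcases List.mem_append.1 hs with hs | hs
  · exact hw s hs
  · exact hw' s hs

lemma IsWordProd.mono (hS : S ⊆ S') (hg : IsWordProd S g k) : IsWordProd S' g k := by
  obtain ⟨w, hw, rfl, rfl⟩ := hg
  exact ⟨w, fun s hs => hS (hw s hs), rfl, rfl⟩

lemma IsWordProd.inv (hS : ∀ s ∈ S, s⁻¹ ∈ S) (hg : IsWordProd S g k) : IsWordProd S g⁻¹ k := by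
  obtain ⟨w, hw, rfl, rfl⟩ := hg
  refine ⟨(w.map fun s => s⁻¹).reverse, fun s hs => ?_, by simp, by
    rw [List.prod_inv_reverse]⟩
  simp only [List.mem_reverse, List.mem_map] at hs
  obtain ⟨t, ht, rfl⟩ := hs
  exact hS t (hw t ht)

lemma IsWordProd.exists_mul_of_succ (hg : IsWordProd S g (k + 1)) :
    ∃ h, ∃ s ∈ S, IsWordProd S h k ∧ g = h * s := by
  obtain ⟨w, hw, hk, rfl⟩ := hg
  have hne : w ≠ [] := by rintro rfl; simp at hk
  refine ⟨w.dropLast.prod, w.getLast hne, hw _ (List.getLast_mem hne),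
    ⟨w.dropLast, fun s hs => hw s (List.mem_of_mem_dropLast hs), by simp [hk], rfl⟩, ?_⟩
  conv_lhs => rw [← List.dropLast_append_getLast hne]
  simp

/-- Words are built by multiplying generators on the right. -/
lemma IsWordProd.induction {p : G → ℕ → Prop} (h1 : p 1 0)
    (hmul : ∀ g k, ∀ s ∈ S, IsWordProd S g k → p g k → p (g * s) (k + 1))
    (hg : IsWordProd S g k) : p g k := by
  induction k generalizing g with
  | zero => rwa [isWordProd_zero.1 hg]
  | succ k ih =>
    obtain ⟨h, s, hs, hh, rfl⟩ := hg.exists_mul_of_succ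
    exact hmul h k s hs hh (ih hh)

lemma finite_setOf_isWordProd (hS : S.Finite) (k : ℕ) : {g | IsWordProd S g k}.Finite := by
  induction k with
  | zero => simp only [isWordProd_zero, Set.ofPred_eq_eq_singleton, Set.finite_singleton]
  | succ k ih =>
    refine (Set.Finite.image2 (fun a b => a * b) ih hS).subset fun g hg => ?_
    obtain ⟨h, s, hs, hh, rfl⟩ := IsWordProd.exists_mul_of_succ hg
    exact ⟨h, hh, s, hs, rfl⟩

lemma isWordProd_image_mulEquiv {H : Type} [Group H] (φ : G ≃* H) :
    IsWordProd (φ '' S) (φ g) k ↔ IsWordProd S g k := by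
  constructor
  · rintro ⟨w, hw, rfl, hg⟩
    refine ⟨w.map φ.symm, fun s hs => ?_, by simp, ?_⟩
    · obtain ⟨t, ht, rfl⟩ := List.mem_map.1 hs
      obtain ⟨r, hr, rfl⟩ := hw t ht
      rwa [φ.symm_apply_apply]
    · rw [List.prod_hom, hg, φ.symm_apply_apply]
  · rintro ⟨w, hw, rfl, rfl⟩
    refine ⟨w.map φ, fun s hs => ?_, by simp, by rw [List.prod_hom]⟩
    obtain ⟨t, ht, rfl⟩ := List.mem_map.1 hs
    exact ⟨t, hw t ht, rfl⟩

lemma growthSeries_image_mulEquiv {H : Type} [Group H] (φ : G ≃* H) (S : Set G) :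
    growthSeries (φ '' S) = growthSeries S := by
  unfold growthSeries
  congr 1
  funext k
  congr 1
  refine (Nat.card_congr (φ.toEquiv.subtypeEquiv fun g => ?_)).symm
  have : ∀ j, IsWordProd (φ '' S) (φ g) j ↔ IsWordProd S g j :=
    fun j => isWordProd_image_mulEquiv φ
  constructor
  · exact fun h => ⟨(this k).2 h.1, fun j hj => h.2 ((this j).1 hj)⟩
  · exact fun h => ⟨(this k).1 h.1, fun j hj => h.2 ((this j).2 hj)⟩

/-- The growth series of a subset `A` of a group, with lengths taken with respect to `S`. -/
def partialGrowth (S A : Set G) : ℚ⟦X⟧ :=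
  PowerSeries.mk fun k => (Nat.card {g : G // HasWordLength S g k ∧ g ∈ A} : ℚ)

lemma finite_hasWordLength (hS : S.Finite) (k : ℕ) : Finite {g : G // HasWordLength S g k} :=
  ((finite_setOf_isWordProd hS k).subset fun _ h => h.1).to_subtype

lemma finite_hasWordLength_and (hS : S.Finite) (A : Set G) (k : ℕ) :
    Finite {g : G // HasWordLength S g k ∧ g ∈ A} :=
  ((finite_setOf_isWordProd hS k).subset fun _ h => h.1.1).to_subtype

lemma constantCoeff_growthSeries (S : Set G) :
    PowerSeries.constantCoeff (growthSeries S) = 1 := by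
  rw [← PowerSeries.coeff_zero_eq_constantCoeff_apply, growthSeries, PowerSeries.coeff_mk]
  have : Nat.card {g : G // HasWordLength S g 0} = 1 := by
    rw [Nat.card_eq_one_iff_unique]
    exact ⟨⟨fun a b => Subtype.ext ((isWordProd_zero.1 a.2.1).trans
      (isWordProd_zero.1 b.2.1).symm)⟩, ⟨⟨1, hasWordLength_one⟩⟩⟩
  rw [this, Nat.cast_one]

/-- Counting by a set of representatives of the cosets of the subgroup generated by `S'`, if
lengths are additive. -/
lemma growthSeries_eq_mul (hS : S.Finite) (hS' : S'.Finite) (hinv : ∀ s ∈ S', s⁻¹ ∈ S')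
    (A : Set G)
    (hex : ∀ g k, HasWordLength S g k → ∃ u ∈ A, ∃ v i j,
      HasWordLength S u i ∧ HasWordLength S' v j ∧ g = u * v)
    (hadd : ∀ u ∈ A, ∀ v i j, HasWordLength S u i → HasWordLength S' v j →
      HasWordLength S (u * v) (i + j)) :
    growthSeries S = partialGrowth S A * growthSeries S' := by
  -- Uniqueness follows from additivity: $u'=ux$ and $u=u'x^{-1}$, where $x$ and $x^{-1}$ have the
  -- same length $l$ over `S'`. Then $i'=i+l$ and $i=i'+l$, so $l=0$.
  have huniq : ∀ u ∈ A, ∀ u' ∈ A, ∀ v v' i i' j j', HasWordLength S u i → HasWordLength S u' i' →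
      HasWordLength S' v j → HasWordLength S' v' j' → u * v = u' * v' → u = u' := by
    intro u hu u' hu' v v' i i' j j' hi hi' hj hj' h
    obtain ⟨l, -, hl⟩ := (hj.isWordProd.mul (hj'.isWordProd.inv hinv)).exists_hasWordLength
    have hl' : HasWordLength S' (v * v'⁻¹)⁻¹ l := by
      refine (hl.isWordProd.inv hinv).hasWordLength fun m hm => hl.le ?_
      simpa using hm.inv hinv
    have h1 : u' = u * (v * v'⁻¹) := by rw [← mul_assoc, h, mul_inv_cancel_right]
    have h2 : u = u' * (v * v'⁻¹)⁻¹ := by rw [h1, mul_inv_cancel_right]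
    have e1 := hadd u hu _ _ _ hi hl
    have e2 := hadd u' hu' _ _ _ hi' hl'
    rw [← h1] at e1
    rw [← h2] at e2
    have e3 := e1.unique hi'
    have e4 := e2.unique hi
    have : l = 0 := by omega
    rw [this] at hl
    rw [h1, isWordProd_zero.1 hl.isWordProd, mul_one]
  ext k
  rw [PowerSeries.coeff_mul, growthSeries, PowerSeries.coeff_mk]
  simp only [partialGrowth, growthSeries, PowerSeries.coeff_mk]
  have : ∀ i, Finite {g : G // HasWordLength S g i ∧ g ∈ A} := finite_hasWordLength_and hS A
  have : ∀ i, Finite {g : G // HasWordLength S' g i} := finite_hasWordLength hS'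
  let f : (Σ p : Finset.HasAntidiagonal.antidiagonal k, {g : G // HasWordLength S g p.1.1 ∧ g ∈ A} ×
      {g : G // HasWordLength S' g p.1.2}) → {g : G // HasWordLength S g k} :=
    fun x => ⟨x.2.1.1 * x.2.2.1, by
      have := hadd _ x.2.1.2.2 _ _ _ x.2.1.2.1 x.2.2.2
      rwa [Finset.HasAntidiagonal.mem_antidiagonal.1 x.1.2] at this⟩
  have hf : Function.Bijective f := by
    constructor
    · rintro ⟨⟨⟨i, j⟩, hp⟩, ⟨u, hu, huA⟩, ⟨v, hv⟩⟩ ⟨⟨⟨i', j'⟩, hp'⟩, ⟨u', hu', huA'⟩, ⟨v', hv'⟩⟩ h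
      have h : u * v = u' * v' := congrArg Subtype.val h
      obtain rfl := huniq u huA u' huA' v v' _ _ _ _ hu hu' hv hv' h
      obtain rfl := mul_left_cancel h
      obtain rfl : i = i' := hu.unique hu'
      obtain rfl : j = j' := hv.unique hv'
      rfl
    · rintro ⟨g, hg⟩
      obtain ⟨u, huA, v, i, j, hu, hv, rfl⟩ := hex g k hg
      have hij : (i, j) ∈ Finset.HasAntidiagonal.antidiagonal k :=
        Finset.HasAntidiagonal.mem_antidiagonal.2 ((hadd u huA v i j hu hv).unique hg)
      exact ⟨⟨⟨(i, j), hij⟩, ⟨u, hu, huA⟩, ⟨v, hv⟩⟩, rfl⟩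
  rw [← Nat.card_congr (Equiv.ofBijective f hf), Nat.card_sigma]
  simp only [Nat.card_prod]
  push_cast
  rw [Finset.univ_eq_attach]
  exact Finset.sum_attach (Finset.HasAntidiagonal.antidiagonal k) (fun p =>
    (Nat.card {g : G // HasWordLength S g p.1 ∧ g ∈ A} : ℚ) *
      (Nat.card {g : G // HasWordLength S' g p.2} : ℚ))

/-- If `A` and `B` have only the identity in common and cover `C`, then their growth series add up
to that of `C`, with the identity counted twice. -/
lemma partialGrowth_add (hS : S.Finite) {A B C : Set G}
    (hA : ∀ g k, HasWordLength S g k → (g ∈ C ↔ g ∈ A ∨ g ∈ B))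
    (hAB : ∀ g k, HasWordLength S g k → (g ∈ A ∧ g ∈ B ↔ g = 1)) :
    partialGrowth S A + partialGrowth S B = partialGrowth S C + 1 := by
  ext k
  simp only [partialGrowth, map_add, PowerSeries.coeff_mk, PowerSeries.coeff_one]
  have hfin : {g | HasWordLength S g k}.Finite :=
    (finite_setOf_isWordProd hS k).subset fun _ h => h.1
  have key : ∀ A : Set G, Nat.card {g : G // HasWordLength S g k ∧ g ∈ A} =
      ({g | HasWordLength S g k ∧ g ∈ A}).ncard := fun A => rfl
  have hunion : {g | HasWordLength S g k ∧ g ∈ C} =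
      {g | HasWordLength S g k ∧ g ∈ A} ∪ {g | HasWordLength S g k ∧ g ∈ B} := by
    ext g
    simp only [Set.mem_ofPred_eq, Set.mem_union]
    constructor
    · rintro ⟨h, hC⟩
      exact ((hA g k h).1 hC).imp (fun h' => ⟨h, h'⟩) fun h' => ⟨h, h'⟩
    · rintro (⟨h, h'⟩ | ⟨h, h'⟩)
      · exact ⟨h, (hA g k h).2 (Or.inl h')⟩
      · exact ⟨h, (hA g k h).2 (Or.inr h')⟩
  have hinter : ({g | HasWordLength S g k ∧ g ∈ A} ∩ {g | HasWordLength S g k ∧ g ∈ B}).ncard =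
      if k = 0 then 1 else 0 := by
    split_ifs with hk
    · subst hk
      rw [Set.ncard_eq_one]
      refine ⟨1, Set.ext fun g => ⟨fun h => ?_, ?_⟩⟩
      · exact isWordProd_zero.1 h.1.1.1
      · rintro rfl
        have := (hAB 1 0 hasWordLength_one).2 rfl
        exact ⟨⟨hasWordLength_one, this.1⟩, ⟨hasWordLength_one, this.2⟩⟩
    · rw [Set.ncard_eq_zero (hfin.subset fun g hg => hg.1.1), Set.eq_empty_iff_forall_notMem]
      rintro g ⟨h, h'⟩
      obtain rfl := (hAB g k h.1).1 ⟨h.2, h'.2⟩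
      exact hk (h.1.unique hasWordLength_one)
  rw [key, key, key, hunion]
  have := Set.ncard_union_add_ncard_inter _ _
    (hfin.subset fun g (hg : g ∈ {g | HasWordLength S g k ∧ g ∈ A}) => hg.1)
    (hfin.subset fun g (hg : g ∈ {g | HasWordLength S g k ∧ g ∈ B}) => hg.1)
  rw [hinter] at this
  exact_mod_cast this.symm

end Words

/-! ### The Lorentzian form and reflections -/

section Form

variable {d : ℕ}

lemma lorentz_comm (x y : Mink d) : lorentz x y = lorentz y x := by
  simp only [lorentz, mul_comm]

@[simp] lemma lorentz_add_left (x y z : Mink d) :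
    lorentz (x + y) z = lorentz x z + lorentz y z := by
  simp only [lorentz, Pi.add_apply, add_mul, Finset.sum_add_distrib]
  ring

@[simp] lemma lorentz_smul_left (a : ℝ) (x y : Mink d) :
    lorentz (a • x) y = a * lorentz x y := by
  simp only [lorentz, Pi.smul_apply, smul_eq_mul, mul_assoc, ← Finset.mul_sum, mul_sub]

@[simp] lemma lorentz_add_right (x y z : Mink d) :
    lorentz x (y + z) = lorentz x y + lorentz x z := by
  rw [lorentz_comm, lorentz_add_left, lorentz_comm y, lorentz_comm z]

@[simp] lemma lorentz_smul_right (a : ℝ) (x y : Mink d) :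
    lorentz x (a • y) = a * lorentz x y := by
  rw [lorentz_comm, lorentz_smul_left, lorentz_comm]

@[simp] lemma lorentz_neg_left (x y : Mink d) : lorentz (-x) y = -lorentz x y := by
  rw [← neg_one_smul ℝ, lorentz_smul_left, neg_one_mul]

@[simp] lemma lorentz_neg_right (x y : Mink d) : lorentz x (-y) = -lorentz x y := by
  rw [lorentz_comm, lorentz_neg_left, lorentz_comm]

@[simp] lemma lorentz_sub_left (x y z : Mink d) :
    lorentz (x - y) z = lorentz x z - lorentz y z := by
  rw [sub_eq_add_neg, lorentz_add_left, lorentz_neg_left, sub_eq_add_neg]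

@[simp] lemma lorentz_sub_right (x y z : Mink d) :
    lorentz x (y - z) = lorentz x y - lorentz x z := by
  rw [sub_eq_add_neg, lorentz_add_right, lorentz_neg_right, sub_eq_add_neg]

@[simp] lemma lorentz_zero_left (x : Mink d) : lorentz 0 x = 0 := by
  simp [lorentz]

@[simp] lemma lorentz_zero_right (x : Mink d) : lorentz x 0 = 0 := by
  simp [lorentz]

/-- The linear form `x ↦ x ∘ e`. -/
def lorentzDual (e : Mink d) : Module.Dual ℝ (Mink d) where
  toFun x := lorentz x e
  map_add' x y := lorentz_add_left x y e
  map_smul' a x := lorentz_smul_left a x e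

@[simp] lemma lorentzDual_apply (e x : Mink d) : lorentzDual e x = lorentz x e := rfl

open Classical in
/-- The reflection in the hyperplane orthogonal to a unit vector `e`. -/
def lorentzReflection (e : Mink d) : Mink d ≃ₗ[ℝ] Mink d :=
  -- The identity is a default for vectors that are not of unit length.
  if h : ((2 : ℝ) • lorentzDual e) e = 2 then Module.reflection h else 1

lemma lorentzReflection_apply {e : Mink d} (he : lorentz e e = 1) (x : Mink d) :
    lorentzReflection e x = x - (2 * lorentz x e) • e := by
  have h : ((2 : ℝ) • lorentzDual e) e = 2 := by simp [he]
  rw [lorentzReflection, dif_pos h, Module.reflection_apply]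
  simp

lemma lorentzReflection_self {e : Mink d} (he : lorentz e e = 1) :
    lorentzReflection e e = -e := by
  rw [lorentzReflection_apply he, he, mul_one, two_smul, sub_add_cancel_left]

lemma lorentzReflection_mul_self {e : Mink d} (he : lorentz e e = 1) :
    lorentzReflection e * lorentzReflection e = 1 := by
  ext1 x
  simp only [LinearEquiv.mul_apply, lorentzReflection_apply he, lorentz_sub_left,
    lorentz_smul_left, he, LinearEquiv.coe_one, id_eq]
  module

lemma lorentzReflection_inv {e : Mink d} (he : lorentz e e = 1) :
    (lorentzReflection e)⁻¹ = lorentzReflection e :=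
  inv_eq_of_mul_eq_one_left (lorentzReflection_mul_self he)

/-- The reflections in the hyperplanes orthogonal to the elements of `E`. -/
def reflections (E : Set (Mink d)) : Set (Mink d ≃ₗ[ℝ] Mink d) := lorentzReflection '' E

lemma setOf_reflection_eq {E : Set (Mink d)} (hE : ∀ e ∈ E, lorentz e e = 1) :
    {r : Mink d ≃ₗ[ℝ] Mink d | ∃ e ∈ E, ∀ x, r x = x - (2 * lorentz x e) • e} =
      reflections E := by
  ext r
  constructor
  · rintro ⟨e, he, hr⟩
    exact ⟨e, he, LinearEquiv.ext fun x => by rw [lorentzReflection_apply (hE e he), hr]⟩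
  · rintro ⟨e, he, rfl⟩
    exact ⟨e, he, lorentzReflection_apply (hE e he)⟩

end Form

/-! ### Alternating products of two reflections -/

section Dihedral

variable {d : ℕ}

/-- The product of `k` reflections `r_e`, `r_f` in turn, the last one being `r_f`. -/
def alternating (e f : Mink d) : ℕ → (Mink d ≃ₗ[ℝ] Mink d)
  | 0 => 1
  | k + 1 => alternating f e k * lorentzReflection f
termination_by k => k

@[simp] lemma alternating_zero (e f : Mink d) : alternating e f 0 = 1 := by
  rw [alternating]

lemma alternating_succ (e f : Mink d) (k : ℕ) :
    alternating e f (k + 1) = alternating f e k * lorentzReflection f := by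
  rw [alternating]

lemma isWordProd_alternating {E : Set (Mink d)} {e f : Mink d} (he : e ∈ E) (hf : f ∈ E) (k : ℕ) :
    IsWordProd (reflections E) (alternating e f k) k := by
  induction k generalizing e f with
  | zero => rw [alternating_zero]; exact isWordProd_one
  | succ k ih =>
    rw [alternating_succ]
    exact (ih hf he).mul (isWordProd_of_mem ⟨f, hf, rfl⟩)

/-- A shortest product of reflections `r_e`, `r_f` is alternating. -/
lemma IsWordProd.eq_alternating {e f : Mink d} (he : lorentz e e = 1) (hf : lorentz f f = 1)
    {u : Mink d ≃ₗ[ℝ] Mink d} {k : ℕ} (hu : IsWordProd (reflections {e, f}) u k) :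
    u = alternating e f k ∨ u = alternating f e k ∨
      ∃ j < k, IsWordProd (reflections {e, f}) u j := by
  have hmem : ∀ e' ∈ ({e, f} : Set (Mink d)), IsWordProd (reflections {e, f})
      (lorentzReflection e') 1 := fun e' he' => isWordProd_of_mem ⟨e', he', rfl⟩
  -- A repeated last letter cancels. The empty word is separate because `k - 1` is truncated there.
  have key : ∀ e f : Mink d, lorentz f f = 1 → ∀ k, alternating e f k * lorentzReflection f =
      alternating f e (k - 1) ∨ k = 0 := by
    intro e f hf k
    cases k with
    | zero => exact Or.inr rfl
    | succ k =>
      rw [alternating_succ, mul_assoc, lorentzReflection_mul_self hf, mul_one]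
      exact Or.inl rfl
  refine IsWordProd.induction (p := fun u k => u = alternating e f k ∨ u = alternating f e k ∨
      ∃ j < k, IsWordProd (reflections {e, f}) u j) (by simp) ?_ hu
  rintro u k _ ⟨e', he', rfl⟩ - (rfl | rfl | ⟨j, hj, h⟩)
  · rcases he' with rfl | rfl
    · exact Or.inr (Or.inl (alternating_succ _ _ _).symm)
    · rcases key e e' hf k with h | rfl
      · rw [h]
        exact Or.inr (Or.inr ⟨k - 1, by omega, isWordProd_alternating (by simp) (by simp) _⟩)
      · simp [alternating_succ]
  · rcases he' with rfl | rfl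
    · rcases key f e' he k with h | rfl
      · rw [h]
        exact Or.inr (Or.inr ⟨k - 1, by omega, isWordProd_alternating (by simp) (by simp) _⟩)
      · simp [alternating_succ]
    · exact Or.inl (alternating_succ _ _ _).symm
  · exact Or.inr (Or.inr ⟨j + 1, by omega, h.mul (hmem e' he')⟩)

/-- The sequence `0, 1, t, t² - 1, …` of values at `t` of (rescaled) Chebyshev polynomials. -/
def chebyshevSeq (t : ℝ) : ℕ → ℝ
  | 0 => 0
  | 1 => 1
  | k + 2 => t * chebyshevSeq t (k + 1) - chebyshevSeq t k

/-- For $t\ge2$ the sequence is increasing, since $ta_{k+1}-a_k\ge a_{k+1}+(a_{k+1}-a_k)$. This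
covers pairs of hyperplanes that do not meet. -/
lemma chebyshevSeq_nonneg {t : ℝ} (ht : 2 ≤ t) (k : ℕ) : 0 ≤ chebyshevSeq t k := by
  have : 0 ≤ chebyshevSeq t k ∧ chebyshevSeq t k ≤ chebyshevSeq t (k + 1) := by
    induction k with
    | zero => simp [chebyshevSeq]
    | succ k ih =>
      refine ⟨ih.1.trans ih.2, ?_⟩
      rw [chebyshevSeq]
      nlinarith [ih.1, ih.2]
  exact this.1

/-- The recursion is the addition formula for the sine, so the terms are $\sin k\theta/\sin\theta$.
-/
lemma sin_mul_chebyshevSeq (θ : ℝ) (k : ℕ) :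
    Real.sin θ * chebyshevSeq (2 * Real.cos θ) k = Real.sin (k * θ) := by
  have : Real.sin θ * chebyshevSeq (2 * Real.cos θ) k = Real.sin (k * θ) ∧
      Real.sin θ * chebyshevSeq (2 * Real.cos θ) (k + 1) = Real.sin ((k + 1 : ℕ) * θ) := by
    induction k with
    | zero => simp [chebyshevSeq]
    | succ k ih =>
      refine ⟨ih.2, ?_⟩
      rw [chebyshevSeq, mul_sub, ih.1, mul_left_comm, ih.2]
      have h1 : ((k + 1 + 1 : ℕ) : ℝ) * θ = (k + 1 : ℕ) * θ + θ := by push_cast; ring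
      have h2 : (k : ℝ) * θ = (k + 1 : ℕ) * θ - θ := by push_cast; ring
      rw [h1, h2, Real.sin_add, Real.sin_sub]
      ring
  exact this.1

/-- Gives the explicit roots of a dihedral group. Which of the two normals receives the larger index
depends on the parity of the length, hence the two clauses; the induction needs both orders of `e`
and `f` at once. -/
lemma alternating_apply {e f : Mink d} (he : lorentz e e = 1) (hf : lorentz f f = 1) (n : ℕ) :
    (alternating e f (2 * n) e = chebyshevSeq (-2 * lorentz e f) (2 * n + 1) • e +
      chebyshevSeq (-2 * lorentz e f) (2 * n) • f) ∧
    (alternating e f (2 * n + 1) e = chebyshevSeq (-2 * lorentz e f) (2 * n + 1) • e +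
      chebyshevSeq (-2 * lorentz e f) (2 * n + 2) • f) := by
  have hstep : ∀ e f : Mink d, lorentz e e = 1 → lorentz f f = 1 → ∀ k,
      alternating e f (k + 2) e = -alternating e f k e +
        (-2 * lorentz e f) • alternating f e (k + 1) f := by
    intro e f he hf k
    rw [alternating_succ, LinearEquiv.mul_apply, lorentzReflection_apply hf, map_sub, map_smul,
      alternating_succ, LinearEquiv.mul_apply, lorentzReflection_self he, map_neg]
    module
  have h1 : ∀ e f : Mink d, lorentz e e = 1 → lorentz f f = 1 →
      alternating e f 1 e = e + (-2 * lorentz e f) • f := by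
    intro e f he hf
    rw [alternating_succ, alternating_zero, one_mul, lorentzReflection_apply hf]
    module
  induction n generalizing e f with
  | zero => simp [h1 e f he hf, chebyshevSeq]
  | succ n ih =>
    obtain ⟨a, b⟩ := ih he hf
    obtain ⟨-, b'⟩ := ih hf he
    have a2 : ∀ e f : Mink d, lorentz e e = 1 → lorentz f f = 1 →
      alternating e f (2 * n) e = chebyshevSeq (-2 * lorentz e f) (2 * n + 1) • e +
      chebyshevSeq (-2 * lorentz e f) (2 * n) • f →
      alternating f e (2 * n + 1) f = chebyshevSeq (-2 * lorentz f e) (2 * n + 1) • f +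
      chebyshevSeq (-2 * lorentz f e) (2 * n + 2) • e →
      alternating e f (2 * n + 2) e = chebyshevSeq (-2 * lorentz e f) (2 * n + 3) • e +
      chebyshevSeq (-2 * lorentz e f) (2 * n + 2) • f := by
      intro e f he hf a b'
      rw [hstep e f he hf, a, b', lorentz_comm f e]
      simp only [chebyshevSeq]
      module
    have ha := a2 e f he hf a b'
    have ha' := a2 f e hf he (ih hf he).1 b
    refine ⟨ha, ?_⟩
    rw [show 2 * (n + 1) = 2 * n + 2 by ring]
    rw [show 2 * n + 2 + 1 = 2 * n + 1 + 2 by ring, hstep e f he hf, b,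
      show 2 * n + 1 + 1 = 2 * n + 2 by ring, ha', lorentz_comm f e]
    simp only [chebyshevSeq]
    module

/-- The coefficients of `alternating e f k e` are `chebyshevSeq` values, in one of two orders. -/
lemma exists_alternating_apply {e f : Mink d} (he : lorentz e e = 1) (hf : lorentz f f = 1)
    (k : ℕ) : ∃ i j, alternating e f k e = chebyshevSeq (-2 * lorentz e f) i • e +
      chebyshevSeq (-2 * lorentz e f) j • f ∧ i ≤ k + 1 ∧ j ≤ k + 1 := by
  obtain ⟨n, rfl | rfl⟩ := Nat.even_or_odd' k
  · exact ⟨_, _, (alternating_apply he hf n).1, by omega, by omega⟩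
  · exact ⟨_, _, (alternating_apply he hf n).2, by omega, by omega⟩

lemma pi_div_pos_lt {m : ℕ} (hm : 2 ≤ m) : 0 < Real.pi / m ∧ Real.pi / m < Real.pi := by
  have hm' : (2 : ℝ) ≤ m := by exact_mod_cast hm
  refine ⟨by have := Real.pi_pos; positivity, ?_⟩
  rw [div_lt_iff₀ (by linarith)]
  nlinarith [Real.pi_pos]

/-- The sign is that of $\sin(k\pi/m)$, whose argument does not exceed $\pi$. -/
lemma chebyshevSeq_cos_pi_div {m : ℕ} (hm : 2 ≤ m) {k : ℕ} (hk : k ≤ m) :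
    0 ≤ chebyshevSeq (2 * Real.cos (Real.pi / m)) k := by
  obtain ⟨h0, h1⟩ := pi_div_pos_lt hm
  have hs := Real.sin_pos_of_pos_of_lt_pi h0 h1
  have h := sin_mul_chebyshevSeq (Real.pi / m) k
  refine nonneg_of_mul_nonneg_right (a := Real.sin (Real.pi / m)) ?_ hs
  rw [h]
  refine Real.sin_nonneg_of_nonneg_of_le_pi (by positivity) ?_
  have hm' : (0 : ℝ) < m := by positivity
  rw [mul_div_assoc', div_le_iff₀ hm', mul_comm]
  exact mul_le_mul_of_nonneg_left (by exact_mod_cast hk) Real.pi_pos.le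

lemma chebyshevSeq_cos_pi_div_self {m : ℕ} (hm : 2 ≤ m) :
    chebyshevSeq (2 * Real.cos (Real.pi / m)) m = 0 := by
  obtain ⟨h0, h1⟩ := pi_div_pos_lt hm
  have hs := Real.sin_pos_of_pos_of_lt_pi h0 h1
  have h := sin_mul_chebyshevSeq (Real.pi / m) m
  have hm' : (m : ℝ) ≠ 0 := by positivity
  rw [mul_div_cancel₀ _ hm', Real.sin_pi] at h
  exact (mul_eq_zero.1 h).resolve_left hs.ne'

lemma chebyshevSeq_cos_pi_div_succ {m : ℕ} (hm : 2 ≤ m) :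
    chebyshevSeq (2 * Real.cos (Real.pi / m)) (m + 1) =
      -chebyshevSeq (2 * Real.cos (Real.pi / m)) (m - 1) := by
  obtain ⟨n, rfl⟩ : ∃ n, m = n + 1 := ⟨m - 1, by omega⟩
  rw [chebyshevSeq, chebyshevSeq_cos_pi_div_self hm]
  simp

lemma alternating_apply_self_swap {e f : Mink d} (he : lorentz e e = 1) (hf : lorentz f f = 1)
    {m : ℕ} (hm : 2 ≤ m) (hef : lorentz e f = -Real.cos (Real.pi / m)) :
    alternating e f m e = alternating f e m e := by
  have ht : -2 * lorentz e f = 2 * Real.cos (Real.pi / m) := by rw [hef]; ring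
  have h0 := chebyshevSeq_cos_pi_div_self hm
  have h1 := chebyshevSeq_cos_pi_div_succ hm
  obtain ⟨k, rfl⟩ : ∃ k, m = k + 1 := ⟨m - 1, by omega⟩
  rw [alternating_succ f e, LinearEquiv.mul_apply, lorentzReflection_self he, map_neg]
  rw [← ht, Nat.add_sub_cancel] at h1
  rw [← ht] at h0
  obtain ⟨n, rfl | rfl⟩ := Nat.even_or_odd' k
  · rw [(alternating_apply he hf n).1, (alternating_apply he hf n).2, h0, h1]
    module
  · have h2 := (alternating_apply he hf (n + 1)).1
    rw [show 2 * (n + 1) = 2 * n + 1 + 1 by ring] at h2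
    rw [h2, (alternating_apply he hf n).2, h1, h0]
    simp

lemma alternating_apply_of_orthogonal {e f z : Mink d} (he : lorentz e e = 1)
    (hf : lorentz f f = 1) (hze : lorentz z e = 0) (hzf : lorentz z f = 0) (k : ℕ) :
    alternating e f k z = z := by
  induction k generalizing e f with
  | zero => simp
  | succ k ih =>
    rw [alternating_succ, LinearEquiv.mul_apply, lorentzReflection_apply hf, hzf]
    simpa using ih hf he hzf hze

/-- The braid relation. -/
lemma alternating_swap {e f : Mink d} (he : lorentz e e = 1) (hf : lorentz f f = 1)
    {m : ℕ} (hm : 2 ≤ m) (hef : lorentz e f = -Real.cos (Real.pi / m)) :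
    alternating e f m = alternating f e m := by
  have h1 := alternating_apply_self_swap he hf hm hef
  have h2 := alternating_apply_self_swap hf he hm (by rw [lorentz_comm, hef])
  obtain ⟨p0, p1⟩ := pi_div_pos_lt hm
  have hs := Real.sin_pos_of_pos_of_lt_pi p0 p1
  -- The Gram determinant of the pair is $\sin^2(\pi/m)$. As it is nonzero, the space splits into
  -- the span of `e`, `f`, where the products agree on both vectors, and its orthogonal complement,
  -- which both fix.
  have hc : 1 - lorentz e f ^ 2 ≠ 0 := by
    rw [hef, neg_sq, ← Real.sin_sq]
    positivity
  ext1 x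
  obtain ⟨z, a, b, hx, hze, hzf⟩ : ∃ (z : Mink d) (a b : ℝ), x = z + a • e + b • f ∧
      lorentz z e = 0 ∧ lorentz z f = 0 := by
    refine ⟨x - ((lorentz x e - lorentz e f * lorentz x f) / (1 - lorentz e f ^ 2)) • e -
      ((lorentz x f - lorentz e f * lorentz x e) / (1 - lorentz e f ^ 2)) • f,
      (lorentz x e - lorentz e f * lorentz x f) / (1 - lorentz e f ^ 2),
      (lorentz x f - lorentz e f * lorentz x e) / (1 - lorentz e f ^ 2), by abel, ?_, ?_⟩
    · simp only [lorentz_sub_left, lorentz_smul_left, he, lorentz_comm f e]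
      field_simp
      ring
    · simp only [lorentz_sub_left, lorentz_smul_left, hf]
      field_simp
      ring
  rw [hx]
  simp only [map_add, map_smul, h1, h2, alternating_apply_of_orthogonal he hf hze hzf,
    alternating_apply_of_orthogonal hf he hzf hze]

lemma exists_alternating_add {E : Set (Mink d)} {e f : Mink d} (he : e ∈ E) (hf : f ∈ E)
    (j k : ℕ) :
    ∃ g, IsWordProd (reflections E) g j ∧ alternating e f (j + k) = g * alternating e f k := by
  induction k generalizing e f with
  | zero => exact ⟨_, isWordProd_alternating he hf j, by simp⟩
  | succ k ih =>
    obtain ⟨g, hg, h⟩ := ih hf he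
    exact ⟨g, hg, by rw [← add_assoc, alternating_succ, h, alternating_succ, mul_assoc]⟩

end Dihedral

/-! ### Timelike and causal vectors -/

section Causal

variable {d : ℕ} {x y u v e f : Mink d}

/-- The open future light cone. -/
def futureCone (d : ℕ) : Set (Mink d) := {x | lorentz x x < 0 ∧ 0 < x (Fin.last d)}

lemma hyperbolicSpace_subset_futureCone : hyperbolicSpace d ⊆ futureCone d :=
  fun x hx => ⟨by rw [hx.1]; norm_num, hx.2⟩

/-- Cauchy–Schwarz for the spatial parts; all sign statements about causal vectors rest on it. -/
lemma lorentz_sq_le (x y : Mink d) :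
    (lorentz x y + x (Fin.last d) * y (Fin.last d)) ^ 2 ≤
      (lorentz x x + x (Fin.last d) ^ 2) * (lorentz y y + y (Fin.last d) ^ 2) := by
  have := Finset.sum_mul_sq_le_sq_mul_sq Finset.univ
    (fun i : Fin d => x i.castSucc) (fun i => y i.castSucc)
  simpa only [lorentz, sub_add_cancel, ← sq, sub_add_cancel] using this

lemma lorentz_self_add_nonneg (x : Mink d) : 0 ≤ lorentz x x + x (Fin.last d) ^ 2 := by
  have : lorentz x x + x (Fin.last d) ^ 2 = ∑ i : Fin d, x i.castSucc * x i.castSucc := by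
    simp only [lorentz]; ring
  rw [this]
  exact Finset.sum_nonneg fun i _ => mul_self_nonneg _

lemma eq_zero_of_last_eq_zero (hu : lorentz u u ≤ 0) (h0 : u (Fin.last d) = 0) : u = 0 := by
  have h1 : ∑ i : Fin d, u i.castSucc * u i.castSucc = 0 := by
    refine le_antisymm ?_ (Finset.sum_nonneg fun i _ => mul_self_nonneg _)
    simpa [lorentz, h0] using hu
  rw [Finset.sum_eq_zero_iff_of_nonneg fun i _ => mul_self_nonneg _] at h1
  funext i
  refine Fin.lastCases h0 (fun i => ?_) i
  simpa using h1 i (Finset.mem_univ _)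

lemma lorentz_neg_of_future (hx : x ∈ futureCone d) (hu : lorentz u u ≤ 0)
    (hu0 : 0 ≤ u (Fin.last d)) (hne : u ≠ 0) : lorentz x u < 0 := by
  obtain ⟨hx1, hx2⟩ := hx
  have hpos : 0 < u (Fin.last d) := lt_of_le_of_ne hu0 fun h =>
    hne (eq_zero_of_last_eq_zero hu h.symm)
  have h1 := lorentz_sq_le x u
  have h2 := lorentz_self_add_nonneg x
  have h3 : (lorentz x u + x (Fin.last d) * u (Fin.last d)) ^ 2 <
      (x (Fin.last d) * u (Fin.last d)) ^ 2 := by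
    have : (lorentz x x + x (Fin.last d) ^ 2) * (lorentz u u + u (Fin.last d) ^ 2) ≤
        (lorentz x x + x (Fin.last d) ^ 2) * u (Fin.last d) ^ 2 :=
      mul_le_mul_of_nonneg_left (by linarith) h2
    have h4 : lorentz x x * u (Fin.last d) ^ 2 < 0 := mul_neg_of_neg_of_pos hx1 (by positivity)
    nlinarith
  have := abs_lt_of_sq_lt_sq h3 (by positivity)
  linarith [(abs_lt.1 this).2]

lemma lorentz_nonpos_of_causal (hx : lorentz x x ≤ 0) (hx0 : 0 ≤ x (Fin.last d))
    (hu : lorentz u u ≤ 0) (hu0 : 0 ≤ u (Fin.last d)) : lorentz x u ≤ 0 := by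
  have h1 := lorentz_sq_le x u
  have h2 := lorentz_self_add_nonneg x
  have h3 : (lorentz x u + x (Fin.last d) * u (Fin.last d)) ^ 2 ≤
      (x (Fin.last d) * u (Fin.last d)) ^ 2 := by
    rw [mul_pow]
    exact h1.trans (mul_le_mul (by linarith) (by linarith) (lorentz_self_add_nonneg u)
      (by positivity))
  have := abs_le_of_sq_le_sq h3 (by positivity)
  linarith [(abs_le.1 this).2]

/-- The form is positive definite on the complement of a timelike vector. -/
lemma eq_zero_of_orthogonal (hx : x ∈ futureCone d) (hu : lorentz u u ≤ 0)
    (hxu : lorentz x u = 0) : u = 0 := by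
  by_contra hne
  rcases le_total 0 (u (Fin.last d)) with h | h
  · exact (lorentz_neg_of_future hx hu h hne).ne hxu
  · refine (lorentz_neg_of_future (u := -u) hx (by simpa using hu) (by simpa using h)
      (by simpa using hne)).ne (by simpa using hxu)

/-- A causal vector that is nonpositive on a timelike future vector is a future vector. -/
lemma last_nonneg_of_lorentz_nonpos (hx : x ∈ futureCone d) (hu : lorentz u u ≤ 0)
    (hxu : lorentz x u ≤ 0) : 0 ≤ u (Fin.last d) := by
  by_contra h
  rw [not_le] at h
  have hne : u ≠ 0 := by rintro rfl; simp at h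
  have := lorentz_neg_of_future (u := -u) hx (by simpa using hu) (by simpa using h.le)
    (by simpa using hne)
  rw [lorentz_neg_right] at this
  linarith

lemma lorentz_neg_of_neg (hx : x ∈ futureCone d) (hy : y ∈ futureCone d) (hu : lorentz u u ≤ 0)
    (hxu : lorentz x u < 0) : lorentz y u < 0 :=
  lorentz_neg_of_future hy hu (last_nonneg_of_lorentz_nonpos hx hu hxu.le)
    (by rintro rfl; simp at hxu)

lemma lorentz_nonpos_of_nonpos (hx : x ∈ futureCone d) (hy : y ∈ futureCone d)
    (hu : lorentz u u ≤ 0) (hxu : lorentz x u ≤ 0) : lorentz y u ≤ 0 :=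
  lorentz_nonpos_of_causal hy.1.le hy.2.le hu (last_nonneg_of_lorentz_nonpos hx hu hxu)

lemma lorentz_causal_nonpos (hx : x ∈ futureCone d) (hu : lorentz u u ≤ 0)
    (hv : lorentz v v ≤ 0) (hxu : lorentz x u ≤ 0) (hxv : lorentz x v ≤ 0) : lorentz u v ≤ 0 :=
  lorentz_nonpos_of_causal hu (last_nonneg_of_lorentz_nonpos hx hu hxu) hv
    (last_nonneg_of_lorentz_nonpos hx hv hxv)

lemma mem_futureCone_of_lorentz_neg (hx : x ∈ futureCone d) (hy : lorentz y y < 0)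
    (hxy : lorentz x y < 0) : y ∈ futureCone d := by
  refine ⟨hy, lt_of_le_of_ne (last_nonneg_of_lorentz_nonpos hx hy.le hxy.le) fun h => ?_⟩
  rw [eq_zero_of_last_eq_zero hy.le h.symm] at hy
  simp at hy

lemma lorentz_neg_of_mem (hx : x ∈ futureCone d) (hy : y ∈ futureCone d) : lorentz x y < 0 :=
  lorentz_neg_of_future hx hy.1.le hy.2.le (by rintro rfl; simpa using hy.2)

lemma add_mem_futureCone (hx : x ∈ futureCone d) (hy : y ∈ futureCone d) :
    x + y ∈ futureCone d := by
  refine ⟨?_, add_pos hx.2 hy.2⟩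
  have := lorentz_neg_of_mem hx hy
  simp only [lorentz_add_left, lorentz_add_right, lorentz_comm y x]
  linarith [hx.1, hy.1]

lemma exists_smul_mem_hyperbolicSpace (hx : x ∈ futureCone d) :
    ∃ a : ℝ, 0 < a ∧ a • x ∈ hyperbolicSpace d := by
  have h : 0 < -lorentz x x := by linarith [hx.1]
  have hs := Real.sqrt_pos.2 h
  refine ⟨(√(-lorentz x x))⁻¹, inv_pos.2 hs, ?_, mul_pos (inv_pos.2 hs) hx.2⟩
  have := Real.mul_self_sqrt h.le
  rw [lorentz_smul_left, lorentz_smul_right]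
  field_simp
  rw [sq, this]
  ring

lemma mem_hyperbolicSpace_iff : x ∈ hyperbolicSpace d ↔ lorentz x x = -1 ∧ x ∈ futureCone d :=
  ⟨fun h => ⟨h.1, hyperbolicSpace_subset_futureCone h⟩, fun h => ⟨h.1, h.2.2⟩⟩

/-- Half spaces with outward normals `e`, `f` such that `e ∘ f ≤ -1` have disjoint complements, if
their intersection is nonempty. -/
lemma lorentz_add_nonpos (he : lorentz e e = 1) (hf : lorentz f f = 1) (hef : lorentz e f ≤ -1)
    (hx : x ∈ futureCone d) (hxe : lorentz x e ≤ 0) (hxf : lorentz x f ≤ 0)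
    (hy : y ∈ futureCone d) : lorentz y e + lorentz y f ≤ 0 := by
  rw [← lorentz_add_right]
  -- The square of $e+f$ is $2+2\,e\circ f\le0$, so $e+f$ is causal and its sign at one future
  -- vector decides its sign at all of them.
  refine lorentz_nonpos_of_nonpos hx hy ?_ (by rw [lorentz_add_right]; linarith)
  simp only [lorentz_add_left, lorentz_add_right, lorentz_comm f e, he, hf]
  linarith

lemma lorentz_add_neg (he : lorentz e e = 1) (hf : lorentz f f = 1) (hef : lorentz e f ≤ -1)
    (hx : x ∈ futureCone d) (hxe : lorentz x e < 0) (hxf : lorentz x f ≤ 0)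
    (hy : y ∈ futureCone d) : lorentz y e + lorentz y f < 0 := by
  rw [← lorentz_add_right]
  refine lorentz_neg_of_neg hx hy ?_ (by rw [lorentz_add_right]; linarith)
  simp only [lorentz_add_left, lorentz_add_right, lorentz_comm f e, he, hf]
  linarith

/-- Half spaces on different sides of a hyperplane that do not meet it are disjoint. -/
lemma lorentz_le_neg_one_of_separated {g : Mink d} (he : lorentz e e = 1) (hf : lorentz f f = 1)
    (hg : lorentz g g = 1) (heg : lorentz e g ≤ -1) (hfg : 1 ≤ lorentz f g)
    (hx : x ∈ futureCone d) (hxg : lorentz x g = 0) (hxe : lorentz x e ≤ 0)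
    (hxf : lorentz x f ≤ 0) : lorentz e f ≤ -1 := by
  -- The projections of `e` and `f` to the complement of `g` are causal, and both are nonpositive at
  -- `x`. Hence $e\circ f\le(e\circ g)(f\circ g)\le-1$.
  have h := lorentz_causal_nonpos (u := e - lorentz e g • g) (v := f - lorentz f g • g) hx
    (by
      simp only [lorentz_sub_left, lorentz_sub_right, lorentz_smul_left, lorentz_smul_right,
        he, hg, lorentz_comm g e]
      nlinarith)
    (by
      simp only [lorentz_sub_left, lorentz_sub_right, lorentz_smul_left, lorentz_smul_right,
        hf, hg, lorentz_comm g f]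
      nlinarith)
    (by simpa [hxg] using hxe) (by simpa [hxg] using hxf)
  simp only [lorentz_sub_left, lorentz_sub_right, lorentz_smul_left, lorentz_smul_right,
    hg, lorentz_comm g f] at h
  nlinarith

lemma lorentz_lorentzReflection (he : lorentz e e = 1) (x y : Mink d) :
    lorentz (lorentzReflection e x) (lorentzReflection e y) = lorentz x y := by
  simp only [lorentzReflection_apply he, lorentz_sub_left, lorentz_sub_right, lorentz_smul_left,
    lorentz_smul_right, he, lorentz_comm e y]
  ring

lemma isHypIsometry_lorentzReflection (he : lorentz e e = 1) :
    IsHypIsometry (lorentzReflection e) := by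
  refine ⟨lorentz_lorentzReflection he, fun x hx => ?_⟩
  rw [mem_hyperbolicSpace_iff, lorentz_lorentzReflection he]
  refine ⟨hx.1, mem_futureCone_of_lorentz_neg (hyperbolicSpace_subset_futureCone hx)
    (by rw [lorentz_lorentzReflection he, hx.1]; norm_num) ?_⟩
  rw [lorentzReflection_apply he, lorentz_sub_right, lorentz_smul_right, hx.1]
  nlinarith [sq_nonneg (lorentz x e)]

end Causal

/-! ### Isometries of hyperbolic space -/

section Isometry

variable {d : ℕ} {g h : Mink d ≃ₗ[ℝ] Mink d}

lemma IsHypIsometry.mul (hg : IsHypIsometry g) (hh : IsHypIsometry h) : IsHypIsometry (g * h) :=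
  ⟨fun x y => by rw [LinearEquiv.mul_apply, LinearEquiv.mul_apply, hg.1, hh.1],
    fun x hx => hg.2 _ (hh.2 x hx)⟩

/-- A point of the lower sheet cannot map to the upper one, because its negative already does. -/
lemma IsHypIsometry.mem_iff (hg : IsHypIsometry g) (x : Mink d) :
    g x ∈ hyperbolicSpace d ↔ x ∈ hyperbolicSpace d := by
  refine ⟨fun hx => ?_, hg.2 x⟩
  have h1 : lorentz x x = -1 := by rw [← hg.1]; exact hx.1
  refine ⟨h1, ?_⟩
  by_contra h
  rw [not_lt] at h
  have hne : x (Fin.last d) ≠ 0 := fun h0 => by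
    rw [eq_zero_of_last_eq_zero (by rw [h1]; norm_num) h0] at h1
    simp at h1
  have h2 : -x ∈ hyperbolicSpace d :=
    ⟨by simpa using h1, by simpa using lt_of_le_of_ne h hne⟩
  have h3 := (hg.2 _ h2).2
  rw [map_neg, Pi.neg_apply] at h3
  linarith [hx.2]

lemma isHypIsometry_of_isWordProd {E : Set (Mink d)} (hE : ∀ e ∈ E, lorentz e e = 1) {k : ℕ}
    (hg : IsWordProd (reflections E) g k) : IsHypIsometry g := by
  refine IsWordProd.induction (p := fun g _ => IsHypIsometry g) ⟨fun x y => rfl, fun x hx => hx⟩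
    ?_ hg
  rintro g k _ ⟨e, he, rfl⟩ - hg
  exact hg.mul (isHypIsometry_lorentzReflection (hE e he))

end Isometry

/-! ### Reflection groups with a fundamental chamber -/

section RootBasis

variable {d : ℕ} {E J : Set (Mink d)}

/-- A finite set of unit vectors which are the outward normals of a chamber with nonempty interior
whose dihedral angles are of the form `π / m`. -/
structure IsRootBasis (E : Set (Mink d)) : Prop where
  finite : E.Finite
  unit : ∀ e ∈ E, lorentz e e = 1
  pair : ∀ e ∈ E, ∀ f ∈ E, e ≠ f →
    (∃ m : ℕ, 2 ≤ m ∧ lorentz e f = -Real.cos (Real.pi / m)) ∨ lorentz e f ≤ -1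
  interior : ∃ x ∈ hyperbolicSpace d, ∀ e ∈ E, lorentz x e < 0

lemma IsRootBasis.mono (hE : IsRootBasis E) (hJ : J ⊆ E) : IsRootBasis J where
  finite := hE.finite.subset hJ
  unit e he := hE.unit e (hJ he)
  pair e he f hf := hE.pair e (hJ he) f (hJ hf)
  interior := by
    obtain ⟨x, hx, h⟩ := hE.interior
    exact ⟨x, hx, fun e he => h e (hJ he)⟩

lemma IsRootBasis.finite_reflections (hE : IsRootBasis E) : (reflections E).Finite :=
  hE.finite.image _

/-- The cone of nonnegative linear combinations of elements of `E`. -/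
def cone (E : Set (Mink d)) : Submodule NNReal (Mink d) := Submodule.span NNReal E

lemma subset_cone : E ⊆ cone E := Submodule.subset_span

lemma cone_mono (h : J ⊆ E) : cone J ≤ cone E := Submodule.span_mono h

lemma smul_mem_cone {a : ℝ} (ha : 0 ≤ a) {x : Mink d} (hx : x ∈ cone E) : a • x ∈ cone E :=
  (cone E).smul_mem (⟨a, ha⟩ : NNReal) hx

lemma map_mem_cone {w : Mink d ≃ₗ[ℝ] Mink d} (hw : ∀ e ∈ J, w e ∈ cone E) {x : Mink d}
    (hx : x ∈ cone J) : w x ∈ cone E := by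
  have : cone J ≤ (cone E).comap ((w : Mink d →ₗ[ℝ] Mink d).restrictScalars NNReal) :=
    Submodule.span_le.2 hw
  exact this hx

/-- An interior point of the chamber is a strictly negative functional on the cone. This makes the
cone pointed, so no root is both positive and negative, even if the normals are linearly dependent.
-/
lemma lorentz_neg_of_mem_cone {x y : Mink d} (hx : ∀ e ∈ E, lorentz x e < 0) (hy : y ∈ cone E) :
    y = 0 ∨ lorentz x y < 0 := by
  induction hy using Submodule.span_induction with
  | mem y hy => exact Or.inr (hx y hy)
  | zero => exact Or.inl rfl
  | add y z _ _ hy hz =>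
    rcases hy with rfl | hy
    · simpa using hz
    rcases hz with rfl | hz
    · simpa using Or.inr hy
    · right
      rw [lorentz_add_right]
      linarith
  | smul a y _ hy =>
    rcases hy with rfl | hy
    · exact Or.inl (smul_zero a)
    rcases eq_or_ne a 0 with rfl | ha
    · exact Or.inl (zero_smul _ y)
    · right
      rw [NNReal.smul_def, lorentz_smul_right]
      exact mul_neg_of_pos_of_neg (NNReal.coe_pos.2 (pos_iff_ne_zero.2 ha)) hy

lemma IsRootBasis.not_mem_cone_neg (hE : IsRootBasis E) {y : Mink d} (hy : y ≠ 0)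
    (h : y ∈ cone E) : -y ∉ cone E := by
  intro h'
  obtain ⟨x, -, hx⟩ := hE.interior
  have h1 := (lorentz_neg_of_mem_cone hx h).resolve_left hy
  have h2 := (lorentz_neg_of_mem_cone hx h').resolve_left (neg_ne_zero.2 hy)
  rw [lorentz_neg_right] at h2
  linarith

lemma IsRootBasis.ne_zero (hE : IsRootBasis E) {e : Mink d} (he : e ∈ E) : e ≠ 0 := by
  rintro rfl
  simpa using hE.unit 0 he

lemma IsRootBasis.inv_mem (hE : IsRootBasis E) : ∀ s ∈ reflections E, s⁻¹ ∈ reflections E := by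
  rintro _ ⟨e, he, rfl⟩
  rw [lorentzReflection_inv (hE.unit e he)]
  exact ⟨e, he, rfl⟩

/-- The case of a dihedral group of `IsRootBasis.apply_mem_cone`. -/
lemma IsRootBasis.apply_mem_cone_pair (hE : IsRootBasis E) {e f : Mink d} (he : e ∈ E)
    (hf : f ∈ E) (hef : e ≠ f) {u : Mink d ≃ₗ[ℝ] Mink d} {k : ℕ}
    (hu : HasWordLength (reflections {e, f}) u k)
    (h : ∀ j, IsWordProd (reflections {e, f}) (u * lorentzReflection e) j → k ≤ j) :
    u e ∈ cone {e, f} := by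
  have he1 := hE.unit e he
  have hf1 := hE.unit f hf
  have hend : ∀ g : Mink d ≃ₗ[ℝ] Mink d, ∀ j, IsWordProd (reflections {e, f}) g j →
      u = g * lorentzReflection e → k ≤ j := by
    rintro g j hg rfl
    refine h j ?_
    rwa [mul_assoc, lorentzReflection_mul_self he1, mul_one]
  have hu' : u = alternating e f k := by
    rcases hu.isWordProd.eq_alternating he1 hf1 with h1 | h1 | ⟨j, hj, h1⟩
    · exact h1
    · cases k with
      | zero => simpa using h1
      | succ k =>
        rw [alternating_succ] at h1
        have := hend _ k (isWordProd_alternating (by simp) (by simp) k) h1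
        omega
    · exact absurd (hu.le h1) (by omega)
  have hcomb : ∀ a b : ℝ, 0 ≤ a → 0 ≤ b → a • e + b • f ∈ cone {e, f} := fun a b ha hb =>
    (cone _).add_mem (smul_mem_cone ha (subset_cone (by simp)))
      (smul_mem_cone hb (subset_cone (by simp)))
  obtain ⟨i, j, hij, hi, hj⟩ := exists_alternating_apply he1 hf1 k
  rw [hu', hij]
  rcases hE.pair e he f hf hef with ⟨m, hm, hc⟩ | hc
  -- If $k\ge m$, the braid relation rewrites the last $m$ letters so that the word ends in $r_e$,
  -- and then $u r_e$ is shorter than $u$. Hence the indices `i`, `j` are at most $k+1\le m$, where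
  -- the coefficients are nonnegative.
  · have hkm : k < m := by
      by_contra hkm
      obtain ⟨n, rfl⟩ : ∃ n, k = n + m := ⟨k - m, by omega⟩
      obtain ⟨g, hg, hgm⟩ := exists_alternating_add (E := {e, f}) (e := e) (f := f)
        (by simp) (by simp) n m
      obtain ⟨l, rfl⟩ : ∃ l, m = l + 1 := ⟨m - 1, by omega⟩
      rw [hgm, alternating_swap he1 hf1 hm hc, alternating_succ, ← mul_assoc] at hu'
      have := hend _ _ (hg.mul (isWordProd_alternating (by simp) (by simp) l)) hu'
      omega
    have ht : -2 * lorentz e f = 2 * Real.cos (Real.pi / m) := by rw [hc]; ring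
    rw [ht]
    exact hcomb _ _ (chebyshevSeq_cos_pi_div hm (by omega))
      (chebyshevSeq_cos_pi_div hm (by omega))
  · exact hcomb _ _ (chebyshevSeq_nonneg (by linarith) _) (chebyshevSeq_nonneg (by linarith) _)

/-- If multiplication by `r_e` does not make `w` shorter, then `w e` is a positive root. -/
theorem IsRootBasis.apply_mem_cone (hE : IsRootBasis E) {w : Mink d ≃ₗ[ℝ] Mink d} {k : ℕ}
    (hw : HasWordLength (reflections E) w k) {e : Mink d} (he : e ∈ E)
    (h : ∀ j, IsWordProd (reflections E) (w * lorentzReflection e) j → k ≤ j) :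
    w e ∈ cone E := by
  classical
  induction k using Nat.strong_induction_on generalizing w e with
  | _ n ih =>
  rcases Nat.eq_zero_or_pos n with rfl | hn
  · rw [isWordProd_zero.1 hw.isWordProd]
    exact subset_cone he
  obtain ⟨k, rfl⟩ : ∃ k, n = k + 1 := ⟨n - 1, by omega⟩
  obtain ⟨w', _, ⟨f, hf, rfl⟩, hw', rfl⟩ := hw.isWordProd.exists_mul_of_succ
  have he1 := hE.unit e he
  have hf1 := hE.unit f hf
  have hef : e ≠ f := by
    rintro rfl
    rw [mul_assoc, lorentzReflection_mul_self he1, mul_one] at h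
    exact absurd (h k hw') (by omega)
  set w := w' * lorentzReflection f with hwdef
  have hsub : reflections {e, f} ⊆ reflections E :=
    Set.image_mono (Set.insert_subset he (Set.singleton_subset_iff.2 hf))
  -- Among the factorisations $w=vu$ with $u$ in the dihedral group of $r_e,r_f$ and additive
  -- lengths, one with $v$ shortest is chosen. Such a $v$ is not shortened by $r_e$ or $r_f$, and it
  -- is shorter than $w$ because $r_f$ splits off. Induction makes $ve$, $vf$ positive, and the
  -- dihedral case puts $ue$ in the cone of `e` and `f`.
  let p : ℕ → Prop := fun a => ∃ v u b, w = v * u ∧ IsWordProd (reflections E) v a ∧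
    IsWordProd (reflections {e, f}) u b ∧ a + b = k + 1
  have hp : p k := ⟨w', lorentzReflection f, 1, rfl, hw', isWordProd_of_mem ⟨f, by simp, rfl⟩, rfl⟩
  have hex : ∃ a, p a := ⟨k, hp⟩
  obtain ⟨v, u, b, hvu, hv, hu, hab⟩ := Nat.find_spec hex
  have hmin : ∀ a, p a → Nat.find hex ≤ a := fun a ha => Nat.find_le ha
  have hle := hmin k hp
  set a := Nat.find hex
  have hvl : HasWordLength (reflections E) v a := hv.hasWordLength fun j hj => by
    have := hw.le (hvu ▸ hj.mul (hu.mono hsub))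
    omega
  have hul : HasWordLength (reflections {e, f}) u b := hu.hasWordLength fun j hj => by
    have := hw.le (hvu ▸ hv.mul (hj.mono hsub))
    omega
  have hpos : ∀ e' ∈ ({e, f} : Set (Mink d)), v e' ∈ cone E := by
    intro e' he'
    have he'E : e' ∈ E := by rcases he' with rfl | rfl <;> assumption
    refine ih a (by omega) hvl he'E fun j hj => ?_
    by_contra hja
    have hw2 : w = (v * lorentzReflection e') * (lorentzReflection e' * u) := by
      rw [mul_assoc, ← mul_assoc (lorentzReflection e'),
        lorentzReflection_mul_self (hE.unit e' he'E), one_mul, hvu]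
    have hu2 : IsWordProd (reflections {e, f}) (lorentzReflection e' * u) (1 + b) :=
      (isWordProd_of_mem (Set.mem_image_of_mem lorentzReflection he')).mul hu
    have h1 := hw.le (hw2 ▸ hj.mul (hu2.mono hsub))
    have := hmin j ⟨_, _, _, hw2, hj, hu2, by omega⟩
    omega
  have hue : u e ∈ cone {e, f} := hE.apply_mem_cone_pair he hf hef hul fun j hj => by
    have := h (a + j) (by rw [hvu, mul_assoc]; exact hv.mul (hj.mono hsub))
    omega
  rw [hvu, LinearEquiv.mul_apply]
  exact map_mem_cone hpos hue

lemma IsRootBasis.hasWordLength_mul (hE : IsRootBasis E) {w : Mink d ≃ₗ[ℝ] Mink d} {k : ℕ}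
    (hw : HasWordLength (reflections E) w k) {e : Mink d} (he : e ∈ E) (hwe : w e ∈ cone E) :
    HasWordLength (reflections E) (w * lorentzReflection e) (k + 1) := by
  have he1 := hE.unit e he
  obtain ⟨l, hl, hlw⟩ :=
    (hw.isWordProd.mul (isWordProd_of_mem ⟨e, he, rfl⟩)).exists_hasWordLength
  rcases hl.eq_or_lt with rfl | hl
  · exact hlw
  · have := hE.apply_mem_cone hlw he fun j hj => by
      rw [mul_assoc, lorentzReflection_mul_self he1, mul_one] at hj
      have := hw.le hj
      omega
    rw [LinearEquiv.mul_apply, lorentzReflection_self he1, map_neg] at this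
    exact absurd this (hE.not_mem_cone_neg
      ((LinearEquiv.map_ne_zero_iff w).2 (hE.ne_zero he)) hwe)

/-- Every root is positive or negative. -/
lemma IsRootBasis.mem_cone_or_neg (hE : IsRootBasis E) {w : Mink d ≃ₗ[ℝ] Mink d} {k : ℕ}
    (hw : HasWordLength (reflections E) w k) {e : Mink d} (he : e ∈ E) :
    w e ∈ cone E ∨ -w e ∈ cone E := by
  have he1 := hE.unit e he
  by_cases h : ∀ j, IsWordProd (reflections E) (w * lorentzReflection e) j → k ≤ j
  · exact Or.inl (hE.apply_mem_cone hw he h)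
  · push Not at h
    obtain ⟨j, hj, hjk⟩ := h
    obtain ⟨l, hl, hlw⟩ := hj.exists_hasWordLength
    have := hE.apply_mem_cone hlw he fun j hj => by
      rw [mul_assoc, lorentzReflection_mul_self he1, mul_one] at hj
      have := hw.le hj
      omega
    rw [LinearEquiv.mul_apply, lorentzReflection_self he1, map_neg] at this
    exact Or.inr this

/-- An element without descents is trivial. -/
lemma IsRootBasis.eq_one_of_forall_mem_cone (hE : IsRootBasis E) (hJ : J ⊆ E)
    {w : Mink d ≃ₗ[ℝ] Mink d} {k : ℕ} (hw : HasWordLength (reflections J) w k)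
    (h : ∀ e ∈ J, w e ∈ cone E) : w = 1 := by
  cases k with
  | zero => exact isWordProd_zero.1 hw.isWordProd
  | succ k =>
    obtain ⟨v, _, ⟨e, he, rfl⟩, hv, rfl⟩ := hw.isWordProd.exists_mul_of_succ
    have hJE := hE.mono hJ
    have hvk : HasWordLength (reflections J) v k := hv.hasWordLength fun j hj => by
      have := hw.le (hj.mul (isWordProd_of_mem ⟨e, he, rfl⟩))
      omega
    have hve := cone_mono hJ (hJE.apply_mem_cone hvk he fun j hj => by
      have := hw.le hj
      omega)
    have := h e he
    rw [LinearEquiv.mul_apply, lorentzReflection_self (hJE.unit e he), map_neg] at this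
    exact absurd this (hE.not_mem_cone_neg
      ((LinearEquiv.map_ne_zero_iff v).2 (hJE.ne_zero he)) hve)

/-- The shortest representatives of the left cosets of the subgroup generated by the reflections
in `J`. -/
def minReps (E J : Set (Mink d)) : Set (Mink d ≃ₗ[ℝ] Mink d) := {u | ∀ e ∈ J, u e ∈ cone E}

/-- Along a reduced word of $v$ each next root lies in the cone of `J`, which $u$ maps into the cone
of `E`. So every letter lengthens the product. -/
lemma IsRootBasis.hasWordLength_mul_of_minReps (hE : IsRootBasis E) (hJ : J ⊆ E)
    {u v : Mink d ≃ₗ[ℝ] Mink d} (hu : u ∈ minReps E J) {i j : ℕ}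
    (hi : HasWordLength (reflections E) u i) (hj : HasWordLength (reflections J) v j) :
    HasWordLength (reflections E) (u * v) (i + j) := by
  induction j generalizing v with
  | zero => rwa [isWordProd_zero.1 hj.isWordProd, mul_one]
  | succ j ih =>
    obtain ⟨v, _, ⟨e, he, rfl⟩, hv, rfl⟩ := hj.isWordProd.exists_mul_of_succ
    have hvk : HasWordLength (reflections J) v j := hv.hasWordLength fun l hl => by
      have := hj.le (hl.mul (isWordProd_of_mem ⟨e, he, rfl⟩))
      omega
    have hve := (hE.mono hJ).apply_mem_cone hvk he fun l hl => by
      have := hj.le hl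
      omega
    rw [← mul_assoc, ← add_assoc]
    exact hE.hasWordLength_mul (ih hvk) (hJ he) (map_mem_cone hu hve)

lemma IsRootBasis.exists_minReps (hE : IsRootBasis E) (hJ : J ⊆ E)
    {g : Mink d ≃ₗ[ℝ] Mink d} {k : ℕ} (hg : HasWordLength (reflections E) g k) :
    ∃ u ∈ minReps E J, ∃ v i j, HasWordLength (reflections E) u i ∧
      HasWordLength (reflections J) v j ∧ g = u * v := by
  classical
  -- The factor $u$ is taken as short as possible: a letter from `J` that shortens $u$ could be
  -- moved into $v$.
  let p : ℕ → Prop := fun a => ∃ u v b, g = u * v ∧ IsWordProd (reflections E) u a ∧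
    IsWordProd (reflections J) v b
  have hex : ∃ a, p a := ⟨k, g, 1, 0, by simp, hg.isWordProd, isWordProd_one⟩
  obtain ⟨u, v, b, hguv, hu, hv⟩ := Nat.find_spec hex
  have hmin : ∀ a, p a → Nat.find hex ≤ a := fun a ha => Nat.find_le ha
  obtain ⟨j, -, hj⟩ := hv.exists_hasWordLength
  have hul : HasWordLength (reflections E) u (Nat.find hex) :=
    hu.hasWordLength fun i hi => hmin i ⟨u, v, b, hguv, hi, hv⟩
  refine ⟨u, fun e he => hE.apply_mem_cone hul (hJ he) fun i hi => hmin i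
    ⟨_, lorentzReflection e * v, 1 + b, ?_, hi,
      (isWordProd_of_mem (Set.mem_image_of_mem lorentzReflection he)).mul hv⟩,
    v, _, j, hul, hj, hguv⟩
  rw [mul_assoc, ← mul_assoc (lorentzReflection e),
    lorentzReflection_mul_self (hE.unit e (hJ he)), one_mul, hguv]

/-- The growth series of the group generated by the reflections in the elements of `E`. -/
def rootGrowth (E : Set (Mink d)) : ℚ⟦X⟧ := growthSeries (reflections E)

lemma rootGrowth_ne_zero (E : Set (Mink d)) :
    PowerSeries.constantCoeff (rootGrowth E) ≠ 0 := by
  rw [rootGrowth, constantCoeff_growthSeries]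
  exact one_ne_zero

lemma IsRootBasis.rootGrowth_eq_mul (hE : IsRootBasis E) (hJ : J ⊆ E) :
    rootGrowth E = partialGrowth (reflections E) (minReps E J) * rootGrowth J :=
  growthSeries_eq_mul hE.finite_reflections (hE.mono hJ).finite_reflections (hE.mono hJ).inv_mem _
    (fun _ _ hg => hE.exists_minReps hJ hg)
    fun _ hu _ _ _ hi hj => hE.hasWordLength_mul_of_minReps hJ hu hi hj

/-- Two hyperplanes that do not meet are not both crossed last. -/
lemma IsRootBasis.not_neg_mem_cone (hE : IsRootBasis E) {e f : Mink d} (he : e ∈ E) (hf : f ∈ E)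
    (hef : lorentz e f ≤ -1) {g : Mink d ≃ₗ[ℝ] Mink d} {k : ℕ}
    (hg : IsWordProd (reflections E) g k) (h1 : -g e ∈ cone E) : -g f ∉ cone E := by
  intro h2
  have hiso := isHypIsometry_of_isWordProd hE.unit hg
  obtain ⟨x, hxH, hx⟩ := hE.interior
  have hne : ∀ e ∈ E, -g e ≠ 0 := fun e he =>
    neg_ne_zero.2 ((LinearEquiv.map_ne_zero_iff g).2 (hE.ne_zero he))
  have h3 := (lorentz_neg_of_mem_cone hx h1).resolve_left (hne e he)
  have h4 := (lorentz_neg_of_mem_cone hx h2).resolve_left (hne f hf)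
  have h5 := lorentz_add_nonpos (e := g e) (f := g f) (x := g x) (y := x)
    (by rw [hiso.1, hE.unit e he]) (by rw [hiso.1, hE.unit f hf]) (by rwa [hiso.1])
    (hyperbolicSpace_subset_futureCone (hiso.2 x hxH)) (by rw [hiso.1]; exact (hx e he).le)
    (by rw [hiso.1]; exact (hx f hf).le) (hyperbolicSpace_subset_futureCone hxH)
  rw [lorentz_neg_right] at h3 h4
  linarith

/-- The growth series of an amalgamated product of reflection groups. -/
theorem IsRootBasis.inv_rootGrowth_union {E₁ E₂ : Set (Mink d)} (hE : IsRootBasis (E₁ ∪ E₂))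
    (h : ∀ e ∈ E₁ \ E₂, ∀ f ∈ E₂ \ E₁, lorentz e f ≤ -1) :
    (rootGrowth (E₁ ∪ E₂))⁻¹ + (rootGrowth (E₁ ∩ E₂))⁻¹ =
      (rootGrowth E₁)⁻¹ + (rootGrowth E₂)⁻¹ := by
  have hsub : E₁ ∩ E₂ ⊆ E₁ ∪ E₂ := Set.inter_subset_left.trans Set.subset_union_left
  -- An element positive on $E_1\cap E_2$ but on neither $E_1$ nor $E_2$ would make negative one
  -- normal from each difference, which disjointness of the hyperplanes forbids. Positivity on all
  -- of $E_1\cup E_2$ forces the identity.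
  have hadd := partialGrowth_add hE.finite_reflections (A := minReps (E₁ ∪ E₂) E₁)
    (B := minReps (E₁ ∪ E₂) E₂) (C := minReps (E₁ ∪ E₂) (E₁ ∩ E₂))
    (by
      intro g k hg
      constructor
      · intro hgm
        by_contra! hcon
        have hcon1 := hcon.1
        have hcon2 := hcon.2
        simp only [minReps, Set.mem_ofPred_eq, not_forall] at hcon1 hcon2
        obtain ⟨e, he, hge⟩ := hcon1
        obtain ⟨f, hf, hgf⟩ := hcon2
        have he2 : e ∉ E₂ := fun h' => hge (hgm e ⟨he, h'⟩)
        have hf1 : f ∉ E₁ := fun h' => hgf (hgm f ⟨h', hf⟩)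
        exact hE.not_neg_mem_cone (Or.inl he) (Or.inr hf) (h e ⟨he, he2⟩ f ⟨hf, hf1⟩)
          hg.isWordProd ((hE.mem_cone_or_neg hg (Or.inl he)).resolve_left hge)
          ((hE.mem_cone_or_neg hg (Or.inr hf)).resolve_left hgf)
      · rintro (hgm | hgm) e he
        · exact hgm e he.1
        · exact hgm e he.2)
    (by
      intro g k hg
      constructor
      · rintro ⟨h1, h2⟩
        exact hE.eq_one_of_forall_mem_cone subset_rfl hg
          fun e he => he.elim (h1 e) (h2 e)
      · rintro rfl
        exact ⟨fun e he => subset_cone (Or.inl he), fun e he => subset_cone (Or.inr he)⟩)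
  have k0 := hE.rootGrowth_eq_mul hsub
  have k1 := hE.rootGrowth_eq_mul Set.subset_union_left
  have k2 := hE.rootGrowth_eq_mul Set.subset_union_right
  have i := PowerSeries.mul_inv_cancel _ (rootGrowth_ne_zero (E₁ ∪ E₂))
  have i0 := PowerSeries.mul_inv_cancel _ (rootGrowth_ne_zero (E₁ ∩ E₂))
  have i1 := PowerSeries.mul_inv_cancel _ (rootGrowth_ne_zero E₁)
  have i2 := PowerSeries.mul_inv_cancel _ (rootGrowth_ne_zero E₂)
  have key : ∀ {P W : ℚ⟦X⟧}, rootGrowth (E₁ ∪ E₂) = P * W → W * W⁻¹ = 1 →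
      (rootGrowth (E₁ ∪ E₂))⁻¹ * P = W⁻¹ := by
    intro P W hP hW
    calc (rootGrowth (E₁ ∪ E₂))⁻¹ * P
        = (rootGrowth (E₁ ∪ E₂))⁻¹ * (P * W) * W⁻¹ := by
          rw [mul_assoc, mul_assoc, hW, mul_one]
      _ = W⁻¹ := by rw [← hP, PowerSeries.inv_mul_cancel _ (rootGrowth_ne_zero _), one_mul]
  rw [← key k0 i0, ← key k1 i1, ← key k2 i2, ← mul_add, hadd]
  ring

lemma lorentzReflection_of_orthogonal {e f : Mink d} (he : lorentz e e = 1)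
    (h : lorentz f e = 0) : lorentzReflection e f = f := by
  rw [lorentzReflection_apply he, h]
  simp

lemma lorentzReflection_commute {e f : Mink d} (he : lorentz e e = 1) (hf : lorentz f f = 1)
    (h : lorentz e f = 0) :
    lorentzReflection e * lorentzReflection f = lorentzReflection f * lorentzReflection e := by
  ext1 x
  simp only [LinearEquiv.mul_apply, lorentzReflection_apply he, lorentzReflection_apply hf,
    lorentz_sub_left, lorentz_smul_left, h, lorentz_comm f e]
  module

/-- The growth series of a product with a group of order two. -/
lemma IsRootBasis.rootGrowth_insert {f : Mink d} (hE : IsRootBasis (insert f J))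
    (hfJ : ∀ e ∈ J, lorentz e f = 0) :
    rootGrowth (insert f J) = (1 + PowerSeries.X) * rootGrowth J := by
  have hf1 := hE.unit f (Set.mem_insert f J)
  have hJ : J ⊆ insert f J := Set.subset_insert f J
  have hword : ∀ g k, IsWordProd (reflections (insert f J)) g k →
      ∃ v j, IsWordProd (reflections J) v j ∧ (g = v ∨ g = v * lorentzReflection f) := by
    intro g k hg
    refine IsWordProd.induction (p := fun g _ => ∃ v j, IsWordProd (reflections J) v j ∧
      (g = v ∨ g = v * lorentzReflection f)) ⟨1, 0, isWordProd_one, Or.inl rfl⟩ ?_ hg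
    rintro _ k _ ⟨e, he, rfl⟩ - ⟨v, j, hv, rfl | rfl⟩
    · rcases he with rfl | he
      · exact ⟨_, _, hv, Or.inr rfl⟩
      · exact ⟨_, _, hv.mul (isWordProd_of_mem ⟨e, he, rfl⟩), Or.inl rfl⟩
    · rcases he with rfl | he
      · exact ⟨_, _, hv, Or.inl (by rw [mul_assoc, lorentzReflection_mul_self hf1, mul_one])⟩
      · refine ⟨_, _, hv.mul (isWordProd_of_mem ⟨e, he, rfl⟩), Or.inr ?_⟩
        rw [mul_assoc, mul_assoc,
          lorentzReflection_commute (hE.unit e (hJ he)) hf1 (hfJ e he)]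
  have hlen : HasWordLength (reflections (insert f J)) (lorentzReflection f) 1 := by
    have := hE.hasWordLength_mul hasWordLength_one (Set.mem_insert f J)
      (subset_cone (Set.mem_insert f J))
    rwa [one_mul] at this
  -- As $r_f$ is central and fixes `J`, the only coset representatives are $1$ and $r_f$, which give
  -- the factor $1+t$.
  have hmem : ∀ g k, HasWordLength (reflections (insert f J)) g k ∧ g ∈ minReps (insert f J) J ↔
      (g = 1 ∧ k = 0) ∨ (g = lorentzReflection f ∧ k = 1) := by
    intro g k
    constructor
    · rintro ⟨hg, hgm⟩
      obtain ⟨v, j, hv, hgv⟩ := hword g k hg.isWordProd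
      obtain ⟨l, -, hl⟩ := hv.exists_hasWordLength
      have hv1 : v = 1 := hE.eq_one_of_forall_mem_cone hJ hl fun e he => by
        rcases hgv with rfl | rfl
        · exact hgm e he
        · have := hgm e he
          rwa [LinearEquiv.mul_apply, lorentzReflection_of_orthogonal hf1 (hfJ e he)] at this
      rw [hv1, one_mul] at hgv
      rcases hgv with rfl | rfl
      · exact Or.inl ⟨rfl, hg.unique hasWordLength_one⟩
      · exact Or.inr ⟨rfl, hg.unique hlen⟩
    · rintro (⟨rfl, rfl⟩ | ⟨rfl, rfl⟩)
      · exact ⟨hasWordLength_one, fun e he => subset_cone (hJ he)⟩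
      · refine ⟨hlen, fun e he => ?_⟩
        rw [lorentzReflection_of_orthogonal hf1 (hfJ e he)]
        exact subset_cone (hJ he)
  have hpart : partialGrowth (reflections (insert f J)) (minReps (insert f J) J) =
      1 + PowerSeries.X := by
    ext k
    simp only [partialGrowth, PowerSeries.coeff_mk, map_add, PowerSeries.coeff_one,
      PowerSeries.coeff_X, hmem]
    rcases k with _ | _ | k
    · simp
    · simp
    · simp
  rw [hE.rootGrowth_eq_mul hJ, hpart]

/-- The growth series of the group obtained by deleting a generator `f` that commutes with or is
free from each of the other generators. -/
lemma IsRootBasis.inv_rootGrowth_diff {f : Mink d} (hE : IsRootBasis E) (hf : f ∈ E)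
    (h : ∀ e ∈ E, e ≠ f → lorentz e f = 0 ∨ lorentz e f ≤ -1) :
    (rootGrowth (E \ {f}))⁻¹ = (rootGrowth E)⁻¹ + (rootGrowth {e ∈ E | lorentz e f = 0})⁻¹ -
      (1 + PowerSeries.X)⁻¹ * (rootGrowth {e ∈ E | lorentz e f = 0})⁻¹ := by
  set J := {e ∈ E | lorentz e f = 0} with hJ
  have hf1 := hE.unit f hf
  have hfJ : f ∉ J := fun h' => by
    have := h'.2
    rw [hf1] at this
    exact one_ne_zero this
  have hins : insert f J ⊆ E := Set.insert_subset hf (Set.sep_subset _ _)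
  have hun : (E \ {f}) ∪ insert f J = E := by
    ext e
    constructor
    · rintro (he | he)
      · exact he.1
      · exact hins he
    · intro he
      by_cases hef : e = f
      · exact Or.inr (Or.inl hef)
      · exact Or.inl ⟨he, hef⟩
  have hint : (E \ {f}) ∩ insert f J = J := by
    ext e
    constructor
    · rintro ⟨⟨_, h2⟩, h3 | h3⟩
      · exact absurd h3 h2
      · exact h3
    · intro he
      exact ⟨⟨he.1, fun h' : e = f => hfJ (h' ▸ he)⟩, Or.inr he⟩
  have h1 := IsRootBasis.inv_rootGrowth_union (E₁ := E \ {f}) (E₂ := insert f J)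
    (by rwa [hun]) (by
      rintro e ⟨⟨he, hef⟩, he'⟩ f' ⟨hf', hf''⟩
      have : f' = f := by
        rcases hf' with rfl | hf'
        · rfl
        · by_contra hne
          exact hf'' ⟨hf'.1, hne⟩
      subst this
      refine (h e he hef).resolve_left fun h0 => he' (Or.inr ⟨he, h0⟩))
  rw [hun, hint, (hE.mono hins).rootGrowth_insert fun e he => he.2, PowerSeries.mul_inv_rev] at h1
  linear_combination -h1

end RootBasis

/-! ### Facets of polytopes without obtuse dihedral angles -/

section Facets

variable {d : ℕ} {E : Set (Mink d)} {U : Submodule ℝ (Mink d)}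

/-- The polytope with outward normals `E` in the hyperbolic subspace `U ∩ H^d`. -/
def chamberIn (U : Submodule ℝ (Mink d)) (E : Set (Mink d)) : Set (Mink d) :=
  {x | x ∈ hyperbolicSpace d ∧ x ∈ U ∧ ∀ e ∈ E, lorentz x e ≤ 0}

/-- The polytope with outward normals `E` in `H^d`. -/
def chamber (E : Set (Mink d)) : Set (Mink d) :=
  {x | x ∈ hyperbolicSpace d ∧ ∀ e ∈ E, lorentz x e ≤ 0}

lemma chamberIn_top (E : Set (Mink d)) : chamberIn ⊤ E = chamber E := by
  ext x
  simp [chamberIn, chamber]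

/-- The interior of the cone over `chamber E`. -/
def openCone (E : Set (Mink d)) : Set (Mink d) :=
  {x | x ∈ futureCone d ∧ ∀ e ∈ E, lorentz x e < 0}

lemma continuous_lorentz_left (y : Mink d) : Continuous fun x : Mink d => lorentz x y := by
  unfold lorentz
  fun_prop

lemma isOpen_openCone (hE : E.Finite) : IsOpen (openCone E) := by
  have h1 : IsOpen (futureCone d) := by
    have hc : Continuous fun x : Mink d => lorentz x x := by
      unfold lorentz
      fun_prop
    exact (isOpen_lt hc continuous_const).inter
      (isOpen_lt continuous_const (continuous_apply (Fin.last d)))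
  have h2 : openCone E = futureCone d ∩ ⋂ e ∈ E, {x | lorentz x e < 0} := by
    ext x
    simp [openCone]
  rw [h2]
  exact h1.inter (hE.isOpen_biInter fun e _ =>
    isOpen_lt (continuous_lorentz_left e) continuous_const)

lemma exists_add_smul_mem_openCone (hE : E.Finite) {p : Mink d} (hp : p ∈ openCone E)
    (y : Mink d) : ∃ a : ℝ, 0 < a ∧ p + a • y ∈ openCone E := by
  have hc : Continuous fun a : ℝ => p + a • y := by fun_prop
  have h0 : ∀ᶠ a : ℝ in nhds 0, p + a • y ∈ openCone E := by
    refine hc.continuousAt.eventually_mem ?_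
    simpa using (isOpen_openCone hE).mem_nhds hp
  obtain ⟨r, hr, h⟩ := Metric.eventually_nhds_iff.1 h0
  refine ⟨r / 2, by positivity, h ?_⟩
  rw [Real.dist_eq, sub_zero, abs_of_pos (by positivity)]
  linarith

lemma exists_smul_mem_chamberIn {p : Mink d} (hp : p ∈ futureCone d) (hpU : p ∈ U)
    (h : ∀ e ∈ E, lorentz p e ≤ 0) : ∃ a : ℝ, 0 < a ∧ a • p ∈ chamberIn U E := by
  obtain ⟨a, ha, hap⟩ := exists_smul_mem_hyperbolicSpace hp
  refine ⟨a, ha, hap, U.smul_mem a hpU, fun e he => ?_⟩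
  rw [lorentz_smul_left]
  exact mul_nonpos_of_nonneg_of_nonpos ha.le (h e he)

lemma mem_span_chamberIn {p : Mink d} (hp : p ∈ futureCone d) (hpU : p ∈ U)
    (h : ∀ e ∈ E, lorentz p e ≤ 0) : p ∈ Submodule.span ℝ (chamberIn U E) := by
  obtain ⟨a, ha, hap⟩ := exists_smul_mem_chamberIn hp hpU h
  have := Submodule.smul_mem _ a⁻¹ (Submodule.subset_span (R := ℝ) hap)
  rwa [inv_smul_smul₀ ha.ne'] at this

/-- An interior point can be moved a little in any direction of `U`, so differences of points of the
cone fill `U`. -/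
lemma span_chamberIn (hE : E.Finite) {p : Mink d} (hp : p ∈ openCone E) (hpU : p ∈ U) :
    Submodule.span ℝ (chamberIn U E) = U := by
  refine le_antisymm (Submodule.span_le.2 fun x hx => hx.2.1) fun y hy => ?_
  obtain ⟨a, ha, hap⟩ := exists_add_smul_mem_openCone hE hp y
  have h1 := mem_span_chamberIn hap.1 (U.add_mem hpU (U.smul_mem a hy)) fun e he => (hap.2 e he).le
  have h2 := mem_span_chamberIn hp.1 hpU fun e he => (hp.2 e he).le
  have := Submodule.smul_mem _ a⁻¹ (Submodule.sub_mem _ h1 h2)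
  rwa [add_sub_cancel_left, inv_smul_smul₀ ha.ne'] at this

lemma finrank_inf_ker_lorentzDual {e : Mink d} (heU : e ∈ U) (he : lorentz e e = 1) :
    Module.finrank ℝ (U ⊓ LinearMap.ker (lorentzDual e) : Submodule ℝ (Mink d)) + 1 =
      Module.finrank ℝ U := by
  have hne : (lorentzDual e).domRestrict U ≠ 0 := fun h => by
    have := LinearMap.congr_fun h ⟨e, heU⟩
    simp [he] at this
  rw [← Module.Dual.finrank_ker_add_one_of_ne_zero hne, LinearMap.ker_domRestrict,
    ← Submodule.finrank_map_subtype_eq, Submodule.map_comap_subtype]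

/-- Projecting to the hyperplane of `e` adds a positive multiple of `e`. Since no angle with `e` is
obtuse, this does not increase the products with the other normals. -/
lemma sub_smul_mem_openCone {F : Set (Mink d)} {e p : Mink d} (he : lorentz e e = 1)
    (hp : p ∈ openCone F) (hpe : lorentz p e < 0) (h : ∀ f ∈ F, lorentz e f ≤ 0) :
    p - lorentz p e • e ∈ openCone F := by
  refine ⟨mem_futureCone_of_lorentz_neg hp.1 ?_ ?_, fun f hf => ?_⟩
  · simp only [lorentz_sub_left, lorentz_sub_right, lorentz_smul_left, lorentz_smul_right, he,
      lorentz_comm e p]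
    nlinarith [hp.1.1]
  · simp only [lorentz_sub_right, lorentz_smul_right]
    nlinarith [hp.1.1]
  · rw [lorentz_sub_left, lorentz_smul_left]
    nlinarith [hp.2 f hf, h f hf]

lemma chamberIn_wall {e : Mink d} :
    {x | x ∈ chamberIn U E ∧ lorentz x e = 0} =
      chamberIn (U ⊓ LinearMap.ker (lorentzDual e)) (E \ {e}) := by
  ext x
  constructor
  · rintro ⟨⟨hx, hxU, hxE⟩, hxe⟩
    exact ⟨hx, ⟨hxU, hxe⟩, fun f hf => hxE f hf.1⟩
  · rintro ⟨hx, ⟨hxU, hxe⟩, hxE⟩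
    refine ⟨⟨hx, hxU, fun f hf => ?_⟩, hxe⟩
    by_cases hfe : f = e
    · rw [hfe]
      exact le_of_eq hxe
    · exact hxE f ⟨hf, hfe⟩

/-- Unit vectors in `U` orthogonal to the same hyperplane of `U` are equal up to sign. -/
lemma eq_or_eq_neg_of_orthogonal {K : Submodule ℝ (Mink d)} {e f p : Mink d} (heU : e ∈ U)
    (hfU : f ∈ U) (he : lorentz e e = 1) (hf : lorentz f f = 1)
    (hK : U ⊓ LinearMap.ker (lorentzDual e) ≤ K) (hKf : ∀ x ∈ K, lorentz x f = 0)
    (hp : p ∈ futureCone d) (hpU : p ∈ U) (hpe : lorentz p e = 0) : f = e ∨ f = -e := by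
  have hz : f - lorentz f e • e ∈ K := by
    refine hK ⟨U.sub_mem hfU (U.smul_mem _ heU), ?_⟩
    simp [he]
  have h1 := hKf _ hz
  have h2 := hKf p (hK ⟨hpU, hpe⟩)
  rw [lorentz_sub_left, lorentz_smul_left, hf, lorentz_comm e f] at h1
  have h3 : f - lorentz f e • e = 0 := by
    refine eq_zero_of_orthogonal hp ?_ (by simp [hpe, h2])
    simp only [lorentz_sub_left, lorentz_sub_right, lorentz_smul_left, lorentz_smul_right, he, hf,
      lorentz_comm e f]
    nlinarith
  have h4 : (lorentz f e - 1) * (lorentz f e + 1) = 0 := by linarith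
  rw [sub_eq_zero] at h3
  rcases mul_eq_zero.1 h4 with h | h
  · left
    rw [h3, show lorentz f e = 1 by linarith, one_smul]
  · right
    rw [h3, show lorentz f e = -1 by linarith, neg_one_smul]

/-- Non-obtuse angles make every inequality essential: the projection of an interior point is
interior to the wall, which therefore has full dimension. The relative form with `U` covers
orthogonal facets as well as full polytopes. -/
theorem facetNormals_chamberIn (hfin : E.Finite) (hEU : E ⊆ U) (hunit : ∀ e ∈ E, lorentz e e = 1)
    (hpair : ∀ e ∈ E, ∀ f ∈ E, e ≠ f → lorentz e f ≤ 0) {p : Mink d} (hp : p ∈ openCone E)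
    (hpU : p ∈ U) : facetNormals (chamberIn U E) = E := by
  have hspan := span_chamberIn hfin hp hpU
  ext e
  simp only [facetNormals, Set.mem_ofPred_eq]
  rw [hspan, chamberIn_wall]
  constructor
  · rintro ⟨heU, he, heP, hrank⟩
    set U' := U ⊓ LinearMap.ker (lorentzDual e)
    have hUle : Submodule.span ℝ (chamberIn U' (E \ {e})) ≤ U' :=
      Submodule.span_le.2 fun x hx => hx.2.1
    have hUeq : Submodule.span ℝ (chamberIn U' (E \ {e})) = U' :=
      Submodule.eq_of_le_of_finrank_eq hUle (by
        have : Module.finrank ℝ U' + 1 = Module.finrank ℝ U := finrank_inf_ker_lorentzDual heU he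
        omega)
    have hpe : lorentz p e ≤ 0 := by
      obtain ⟨a, ha, hap⟩ := exists_smul_mem_chamberIn hp.1 hpU fun f hf => (hp.2 f hf).le
      have := heP _ hap
      rw [lorentz_smul_left] at this
      by_contra h
      exact absurd (mul_pos ha (not_le.1 h)) (not_lt.2 this)
    have hq : p - lorentz p e • e ∈ futureCone d := by
      refine mem_futureCone_of_lorentz_neg hp.1 ?_ ?_
      · simp only [lorentz_sub_left, lorentz_sub_right, lorentz_smul_left, lorentz_smul_right, he,
          lorentz_comm e p]
        nlinarith [hp.1.1]
      · simp only [lorentz_sub_right, lorentz_smul_right]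
        nlinarith [hp.1.1]
    have hqe : lorentz (p - lorentz p e • e) e = 0 := by simp [he]
    have hqU : p - lorentz p e • e ∈ U := U.sub_mem hpU (U.smul_mem _ heU)
    have hne : (chamberIn U' (E \ {e})).Nonempty := by
      by_contra h
      rw [Set.not_nonempty_iff_eq_empty] at h
      rw [h, Submodule.span_empty] at hUeq
      have : p - lorentz p e • e ∈ (⊥ : Submodule ℝ (Mink d)) := hUeq ▸ ⟨hqU, hqe⟩
      rw [(Submodule.mem_bot ℝ).1 this] at hq
      simpa using hq.2
    -- some element of `E` vanishes on the whole facet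
    obtain ⟨f, hf, hfP⟩ : ∃ f ∈ E, ∀ x ∈ chamberIn U' (E \ {e}), lorentz x f = 0 := by
      by_contra! hcon
      -- Otherwise a sum of points of the facet, one off the hyperplane of each `f`, is strictly
      -- inside all half-spaces of `E`. Moving it slightly along `e` stays in the polytope but
      -- violates the inequality for `e`.
      have hex : ∃ q ∈ futureCone d, q ∈ U' ∧ ∀ f ∈ E, lorentz q f < 0 := by
        have : ∀ s : Set (Mink d), s.Finite → s ⊆ E → ∃ q ∈ futureCone d, q ∈ U' ∧
            (∀ f ∈ E, lorentz q f ≤ 0) ∧ ∀ f ∈ s, lorentz q f < 0 := by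
          intro s hs
          induction s, hs using Set.Finite.induction_on with
          | empty =>
            obtain ⟨q, hq⟩ := hne
            rw [← chamberIn_wall] at hq
            exact fun _ => ⟨q, hyperbolicSpace_subset_futureCone hq.1.1, ⟨hq.1.2.1, hq.2⟩,
              hq.1.2.2, by simp⟩
          | @insert f s _ _ ih =>
            intro hsE
            obtain ⟨q, hq, hqU, hqE, hqs⟩ := ih ((Set.subset_insert f s).trans hsE)
            obtain ⟨x, hx, hxf⟩ := hcon f (hsE (Set.mem_insert f s))
            rw [← chamberIn_wall] at hx
            refine ⟨q + x, add_mem_futureCone hq (hyperbolicSpace_subset_futureCone hx.1.1),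
              U'.add_mem hqU ⟨hx.1.2.1, hx.2⟩, fun f' hf' => ?_, fun f' hf' => ?_⟩
            · rw [lorentz_add_left]
              linarith [hqE f' hf', hx.1.2.2 f' hf']
            · rw [lorentz_add_left]
              rcases hf' with rfl | hf'
              · have hfE := hsE (Set.mem_insert f' s)
                linarith [hqE f' hfE, lt_of_le_of_ne (hx.1.2.2 f' hfE) hxf]
              · linarith [hqs f' hf', hx.1.2.2 f' (hsE (Or.inr hf'))]
        obtain ⟨q, h1, h2, -, h3⟩ := this E hfin subset_rfl
        exact ⟨q, h1, h2, h3⟩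
      obtain ⟨q, hq, hqU, hqE⟩ := hex
      obtain ⟨a, ha, hae⟩ := exists_add_smul_mem_openCone hfin ⟨hq, hqE⟩ e
      obtain ⟨b, hb, hbe⟩ := exists_smul_mem_chamberIn hae.1
        (U.add_mem hqU.1 (U.smul_mem a heU)) fun f hf => (hae.2 f hf).le
      have h1 := heP _ hbe
      have h2 : lorentz q e = 0 := hqU.2
      rw [lorentz_smul_left, lorentz_add_left, lorentz_smul_left, h2, he] at h1
      have := mul_pos hb ha
      linarith
    have hfK : ∀ x ∈ U', lorentz x f = 0 := by
      rw [← hUeq]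
      have : Submodule.span ℝ (chamberIn U' (E \ {e})) ≤ LinearMap.ker (lorentzDual f) :=
        Submodule.span_le.2 hfP
      exact this
    rcases eq_or_eq_neg_of_orthogonal heU (hEU hf) he (hunit f hf) le_rfl hfK hq hqU hqe
      with rfl | rfl
    · exact hf
    · have := hp.2 _ hf
      rw [lorentz_neg_right] at this
      linarith
  · intro he
    refine ⟨hEU he, hunit e he, fun x hx => hx.2.2 e he, ?_⟩
    rw [span_chamberIn (p := p - lorentz p e • e) (hfin.subset Set.sdiff_subset) ?_ ?_,
      finrank_inf_ker_lorentzDual (hEU he) (hunit e he)]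
    · exact sub_smul_mem_openCone (hunit e he) ⟨hp.1, fun f hf => hp.2 f hf.1⟩ (hp.2 e he)
        fun f hf => hpair e he f hf.1 fun h => hf.2 h.symm
    · exact ⟨U.sub_mem hpU (U.smul_mem _ (hEU he)), by simp [hunit e he]⟩

end Facets

/-! ### Coxeter polytopes and their orthogonal facets -/

section Coxeter

variable {d : ℕ} {E : Set (Mink d)}

lemma IsRootBasis.lorentz_nonpos (hE : IsRootBasis E) : ∀ e ∈ E, ∀ f ∈ E, e ≠ f →
    lorentz e f ≤ 0 := by
  intro e he f hf hef
  rcases hE.pair e he f hf hef with ⟨m, hm, h⟩ | h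
  · rw [h, neg_nonpos]
    have hm' : (2 : ℝ) ≤ m := by exact_mod_cast hm
    refine Real.cos_nonneg_of_neg_pi_div_two_le_of_le ?_ ?_
    · have := Real.pi_pos
      have : 0 ≤ Real.pi / m := by positivity
      linarith
    · exact div_le_div_of_nonneg_left Real.pi_pos.le two_pos hm'
  · linarith

lemma IsRootBasis.exists_mem_openCone (hE : IsRootBasis E) : ∃ p, p ∈ openCone E := by
  obtain ⟨p, hp, h⟩ := hE.interior
  exact ⟨p, hyperbolicSpace_subset_futureCone hp, h⟩

lemma IsRootBasis.facetNormals_chamber (hE : IsRootBasis E) : facetNormals (chamber E) = E := by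
  obtain ⟨p, hp⟩ := hE.exists_mem_openCone
  rw [← chamberIn_top]
  exact facetNormals_chamberIn hE.finite (fun _ _ => Submodule.mem_top) hE.unit hE.lorentz_nonpos
    hp Submodule.mem_top

lemma polytopeGrowth_eq {P : Set (Mink d)} (hE : ∀ e ∈ E, lorentz e e = 1)
    (hP : facetNormals P = E) : polytopeGrowth P = rootGrowth E := by
  rw [polytopeGrowth, facetReflections, hP, setOf_reflection_eq hE, rootGrowth]

lemma IsRootBasis.polytopeGrowth_chamber (hE : IsRootBasis E) :
    polytopeGrowth (chamber E) = rootGrowth E :=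
  polytopeGrowth_eq hE.unit hE.facetNormals_chamber

theorem IsRootBasis.isCoxeterPolytope_chamber (hE : IsRootBasis E) :
    IsCoxeterPolytope (chamber E) := by
  obtain ⟨p, hp, hpE⟩ := hE.interior
  refine ⟨⟨?_, openCone E, isOpen_openCone hE.finite,
    ⟨p, ⟨hyperbolicSpace_subset_futureCone hp, hpE⟩, hp⟩,
    fun x hx => ⟨hx.2, fun e he => (hx.1.2 e he).le⟩⟩, ?_⟩
  · obtain ⟨k, e, he⟩ := hE.finite.fin_embedding
    refine ⟨k, e, fun i => hE.unit _ (he ▸ Set.mem_range_self i), ?_⟩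
    simp only [chamber, halfSpaces, ← he, Set.forall_mem_range]
  · rw [hE.facetNormals_chamber]
    rintro e he f hf hef ⟨x, hx, hxe, hxf⟩
    rcases hE.pair e he f hf hef with ⟨m, hm, h⟩ | h
    · exact ⟨m, hm, by rw [h, neg_neg]⟩
    · exfalso
      have h1 := lorentz_add_neg (hE.unit e he) (hE.unit f hf) h
        (hyperbolicSpace_subset_futureCone hp) (hpE e he) (hpE f hf).le
        (hyperbolicSpace_subset_futureCone hx)
      linarith

/-- The elements of `E` orthogonal to `f`. -/
def link (E : Set (Mink d)) (f : Mink d) : Set (Mink d) := {e ∈ E | lorentz e f = 0}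

lemma link_subset (E : Set (Mink d)) (f : Mink d) : link E f ⊆ E := Set.sep_subset _ _

/-- The face of `chamber E` in the hyperplane orthogonal to `f`. -/
def wall (E : Set (Mink d)) (f : Mink d) : Set (Mink d) := {x | x ∈ chamber E ∧ lorentz x f = 0}

/-- `f` is orthogonal to the facets that meet it. -/
def IsOrthogonalNormal (E : Set (Mink d)) (f : Mink d) : Prop :=
  f ∈ E ∧ ∀ e ∈ E, e ≠ f → lorentz e f = 0 ∨ lorentz e f ≤ -1

/-- Half-spaces whose normal has product at most $-1$ with `f` contain the whole hyperplane of `f`,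
so only the link cuts out the facet. -/
lemma IsRootBasis.wall_eq (hE : IsRootBasis E) {f : Mink d} (hf : IsOrthogonalNormal E f) :
    wall E f = chamberIn (LinearMap.ker (lorentzDual f)) (link E f) := by
  obtain ⟨p, hp⟩ := hE.exists_mem_openCone
  ext x
  constructor
  · rintro ⟨⟨hx, hxE⟩, hxf⟩
    exact ⟨hx, hxf, fun e he => hxE e he.1⟩
  · rintro ⟨hx, hxf, hxE⟩
    have hxf : lorentz x f = 0 := hxf
    refine ⟨⟨hx, fun e he => ?_⟩, hxf⟩
    by_cases hef : e = f
    · rw [hef, hxf]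
    rcases hf.2 e he hef with h | h
    · exact hxE e ⟨he, h⟩
    · have := lorentz_add_nonpos (hE.unit e he) (hE.unit f hf.1) h hp.1 (hp.2 e he).le
        (hp.2 f hf.1).le (hyperbolicSpace_subset_futureCone hx)
      linarith

lemma IsRootBasis.exists_mem_wall (hE : IsRootBasis E) {f : Mink d} (hf : f ∈ E) :
    ∃ q, q ∈ openCone (E \ {f}) ∧ lorentz q f = 0 := by
  obtain ⟨p, hp⟩ := hE.exists_mem_openCone
  refine ⟨p - lorentz p f • f, ?_, by simp [hE.unit f hf]⟩
  exact sub_smul_mem_openCone (hE.unit f hf) ⟨hp.1, fun e he => hp.2 e he.1⟩ (hp.2 f hf)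
    fun e he => hE.lorentz_nonpos f hf e he.1 fun h => he.2 h.symm

lemma IsRootBasis.exists_mem_openCone_link (hE : IsRootBasis E) {f : Mink d} (hf : f ∈ E) :
    ∃ q, q ∈ openCone (link E f) ∧ lorentz q f = 0 := by
  obtain ⟨q, hq, hqf⟩ := hE.exists_mem_wall hf
  refine ⟨q, ⟨hq.1, fun e he => hq.2 e ⟨he.1, ?_⟩⟩, hqf⟩
  rintro rfl
  have := he.2
  rw [hE.unit e hf] at this
  exact one_ne_zero this

lemma IsRootBasis.facetNormals_wall (hE : IsRootBasis E) {f : Mink d}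
    (hf : IsOrthogonalNormal E f) : facetNormals (wall E f) = link E f := by
  obtain ⟨q, hq, hqf⟩ := hE.exists_mem_openCone_link hf.1
  rw [hE.wall_eq hf]
  exact facetNormals_chamberIn (hE.finite.subset (link_subset E f)) (fun e he => he.2)
    (fun e he => hE.unit e he.1) (fun e he e' he' => hE.lorentz_nonpos e he.1 e' he'.1) hq hqf

lemma IsRootBasis.span_wall (hE : IsRootBasis E) {f : Mink d} (hf : IsOrthogonalNormal E f) :
    Submodule.span ℝ (wall E f) = LinearMap.ker (lorentzDual f) := by
  obtain ⟨q, hq, hqf⟩ := hE.exists_mem_openCone_link hf.1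
  rw [hE.wall_eq hf]
  exact span_chamberIn (hE.finite.subset (link_subset E f)) hq hqf

lemma IsRootBasis.polytopeGrowth_wall (hE : IsRootBasis E) {f : Mink d}
    (hf : IsOrthogonalNormal E f) : polytopeGrowth (wall E f) = rootGrowth (link E f) :=
  polytopeGrowth_eq (fun e he => hE.unit e he.1) (hE.facetNormals_wall hf)

end Coxeter

/-! ### Gluing along an orthogonal facet -/

section Matching

variable {d : ℕ} {E₁ E₂ : Set (Mink d)} {f : Mink d}

/-- The chambers with outward normals `E₁` and `E₂` lie on different sides of the hyperplane
orthogonal to `f`, and have the same orthogonal facet in this hyperplane. -/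
structure IsMatching (E₁ E₂ : Set (Mink d)) (f : Mink d) : Prop where
  left : IsRootBasis E₁
  right : IsRootBasis E₂
  normal_left : IsOrthogonalNormal E₁ f
  normal_right : IsOrthogonalNormal E₂ (-f)
  link_eq : link E₁ f = link E₂ (-f)

/-- The outward normals of the union of two chambers glued along a common facet. -/
def glued (E₁ E₂ : Set (Mink d)) (f : Mink d) : Set (Mink d) := E₁ \ {f} ∪ E₂ \ {-f}

lemma glued_comm (E₁ E₂ : Set (Mink d)) (f : Mink d) : glued E₂ E₁ (-f) = glued E₁ E₂ f := by
  rw [glued, glued, neg_neg, Set.union_comm]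

namespace IsMatching

lemma symm (h : IsMatching E₁ E₂ f) : IsMatching E₂ E₁ (-f) where
  left := h.right
  right := h.left
  normal_left := h.normal_right
  normal_right := by rw [neg_neg]; exact h.normal_left
  link_eq := by rw [neg_neg]; exact h.link_eq.symm

lemma unit (h : IsMatching E₁ E₂ f) : lorentz f f = 1 := h.left.unit f h.normal_left.1

lemma ne_of_mem_link (h : IsMatching E₁ E₂ f) {e : Mink d} (he : e ∈ link E₁ f) :
    e ≠ f ∧ e ≠ -f := by
  have h1 := h.unit
  have h2 := he.2
  constructor
  · rintro rfl
    rw [h1] at h2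
    exact one_ne_zero h2
  · rintro rfl
    rw [lorentz_neg_left, h1] at h2
    norm_num at h2

lemma mem_link_or (h : IsMatching E₁ E₂ f) {e : Mink d} (he : e ∈ E₁ \ {f}) :
    e ∈ link E₁ f ∧ e ∈ E₂ \ {-f} ∨ lorentz e f ≤ -1 := by
  rcases h.normal_left.2 e he.1 he.2 with h' | h'
  · have hl : e ∈ link E₁ f := ⟨he.1, h'⟩
    exact Or.inl ⟨hl, link_subset _ _ (h.link_eq ▸ hl), (h.ne_of_mem_link hl).2⟩
  · exact Or.inr h'

/-- The first chamber satisfies all inequalities of the second except the one being glued: those of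
the link are shared, and the other half-spaces contain the far side of the hyperplane. Adding the
second chamber thus removes only `f` and `-f`. -/
lemma lorentz_nonpos (h : IsMatching E₁ E₂ f) {x e : Mink d} (hx : x ∈ chamber E₁)
    (he : e ∈ E₂ \ {-f}) : lorentz x e ≤ 0 := by
  rcases h.symm.mem_link_or he with ⟨-, he'⟩ | he'
  · exact hx.2 e (he'.1)
  · obtain ⟨q, hq⟩ := h.right.exists_mem_openCone
    have := lorentz_add_nonpos (h.right.unit e he.1) (h.right.unit _ h.normal_right.1) he' hq.1
      (hq.2 e he.1).le (hq.2 _ h.normal_right.1).le (hyperbolicSpace_subset_futureCone hx.1)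
    rw [lorentz_neg_right] at this
    linarith [hx.2 f h.normal_left.1]

lemma lorentz_neg (h : IsMatching E₁ E₂ f) {x e : Mink d} (hx : x ∈ openCone E₁)
    (he : e ∈ E₂ \ {-f}) : lorentz x e < 0 := by
  rcases h.symm.mem_link_or he with ⟨-, he'⟩ | he'
  · exact hx.2 e (he'.1)
  · obtain ⟨q, hq⟩ := h.right.exists_mem_openCone
    have := lorentz_add_nonpos (h.right.unit e he.1) (h.right.unit _ h.normal_right.1) he' hq.1
      (hq.2 e he.1).le (hq.2 _ h.normal_right.1).le hx.1
    rw [lorentz_neg_right] at this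
    linarith [hx.2 f h.normal_left.1]

/-- Hyperplanes that miss the common wall on opposite sides are separated by it. An interior point
of the wall serves as the point required for `lorentz_le_neg_one_of_separated`. -/
lemma lorentz_le_neg_one (h : IsMatching E₁ E₂ f) {e e' : Mink d} (he : e ∈ E₁)
    (he' : e' ∈ E₂) (h1 : lorentz e f ≤ -1) (h2 : lorentz e' (-f) ≤ -1) : lorentz e e' ≤ -1 := by
  have hu := h.unit
  obtain ⟨q, hq, hqf⟩ := h.left.exists_mem_wall h.normal_left.1
  have hne : e ≠ f := by
    rintro rfl
    linarith
  obtain ⟨p, hp⟩ := h.right.exists_mem_openCone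
  rw [lorentz_neg_right] at h2
  refine lorentz_le_neg_one_of_separated (h.left.unit e he) (h.right.unit e' he') hu h1
    (by linarith) hq.1 hqf (hq.2 e ⟨he, hne⟩).le ?_
  have := lorentz_add_nonpos (h.right.unit e' he') (h.right.unit _ h.normal_right.1)
    (by rw [lorentz_neg_right]; linarith) hp.1
      (hp.2 e' he').le (hp.2 _ h.normal_right.1).le hq.1
  rw [lorentz_neg_right, hqf] at this
  linarith

lemma isRootBasis (h : IsMatching E₁ E₂ f) : IsRootBasis (glued E₁ E₂ f) where
  finite := (h.left.finite.subset Set.sdiff_subset).union (h.right.finite.subset Set.sdiff_subset)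
  unit e he := he.elim (fun he => h.left.unit e he.1) fun he => h.right.unit e he.1
  pair := by
    have key : ∀ {E₁ E₂ : Set (Mink d)} {f : Mink d}, IsMatching E₁ E₂ f →
        ∀ e ∈ E₁ \ {f}, ∀ e' ∈ E₂ \ {-f}, e ≠ e' →
        (∃ m : ℕ, 2 ≤ m ∧ lorentz e e' = -Real.cos (Real.pi / m)) ∨ lorentz e e' ≤ -1 := by
      intro E₁ E₂ f h e he e' he' hne
      rcases h.mem_link_or he with ⟨-, h1⟩ | h1
      · exact h.right.pair e h1.1 e' he'.1 hne
      rcases h.symm.mem_link_or he' with ⟨-, h2⟩ | h2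
      · exact h.left.pair e he.1 e' h2.1 hne
      · exact Or.inr (h.lorentz_le_neg_one he.1 he'.1 h1 h2)
    rintro e (he | he) e' (he' | he') hne
    · exact h.left.pair e he.1 e' he'.1 hne
    · exact key h e he e' he' hne
    · exact key h.symm e he e' (by rwa [neg_neg]) hne
    · exact h.right.pair e he.1 e' he'.1 hne
  interior := by
    obtain ⟨x, hx, hxE⟩ := h.left.interior
    refine ⟨x, hx, fun e he => he.elim (fun he => hxE e he.1) fun he => ?_⟩
    exact h.lorentz_neg ⟨hyperbolicSpace_subset_futureCone hx, hxE⟩ he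

lemma chamber_glued (h : IsMatching E₁ E₂ f) :
    chamber (glued E₁ E₂ f) = chamber E₁ ∪ chamber E₂ := by
  have key : ∀ {E₁ E₂ : Set (Mink d)} {f : Mink d}, IsMatching E₁ E₂ f →
      (chamber E₁ ⊆ chamber (glued E₁ E₂ f)) ∧
      ∀ x ∈ chamber (glued E₁ E₂ f), lorentz x f ≤ 0 → x ∈ chamber E₁ := by
    intro E₁ E₂ f h
    refine ⟨fun x hx => ⟨hx.1, fun e he => he.elim (fun he => hx.2 e he.1) fun he =>
      h.lorentz_nonpos hx he⟩, fun x hx hxf => ⟨hx.1, fun e he => ?_⟩⟩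
    by_cases hef : e = f
    · rwa [hef]
    · exact hx.2 e (Or.inl ⟨he, hef⟩)
  have k1 := key h
  have k2 := key h.symm
  rw [glued_comm] at k2
  refine Set.Subset.antisymm (fun x hx => ?_) (Set.union_subset k1.1 k2.1)
  rcases le_total (lorentz x f) 0 with hxf | hxf
  · exact Or.inl (k1.2 x hx hxf)
  · exact Or.inr (k2.2 x hx (by rw [lorentz_neg_right]; linarith))

/-- The growth series of a union of polytopes glued along an orthogonal facet. -/
theorem inv_rootGrowth_glued (h : IsMatching E₁ E₂ f) :
    (rootGrowth (glued E₁ E₂ f))⁻¹ = (rootGrowth E₁)⁻¹ + (rootGrowth E₂)⁻¹ +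
      (PowerSeries.X - 1) * (PowerSeries.X + 1)⁻¹ * (rootGrowth (link E₁ f))⁻¹ := by
  have hint : (E₁ \ {f}) ∩ (E₂ \ {-f}) = link E₁ f := by
    ext e
    constructor
    · rintro ⟨he, he'⟩
      rcases h.mem_link_or he with h1 | h1
      · exact h1.1
      rcases h.normal_right.2 e he'.1 he'.2 with h2 | h2 <;> rw [lorentz_neg_right] at h2 <;>
        linarith
    · intro he
      exact ⟨⟨he.1, (h.ne_of_mem_link he).1⟩,
        link_subset _ _ (h.link_eq ▸ he), (h.ne_of_mem_link he).2⟩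
  -- Write $L$ for the link. The amalgam over $L$ gives $-1/W_L$, and the two deletions give
  -- $2/W_L-2/((1+t)W_L)$. The sum is $\frac{t-1}{t+1}\frac1{W_L}$.
  have h0 := IsRootBasis.inv_rootGrowth_union (E₁ := E₁ \ {f}) (E₂ := E₂ \ {-f}) h.isRootBasis
    (by
      rintro e ⟨he, he2⟩ e' ⟨he', he1⟩
      refine h.lorentz_le_neg_one he.1 he'.1 ((h.mem_link_or he).resolve_left fun h1 => he2 h1.2)
        ((h.symm.mem_link_or he').resolve_left fun h2 => he1 ?_)
      simpa using h2.2)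
  have h1 := h.left.inv_rootGrowth_diff h.normal_left.1 h.normal_left.2
  have h2 := h.right.inv_rootGrowth_diff h.normal_right.1 h.normal_right.2
  have hl : {e ∈ E₂ | lorentz e (-f) = 0} = link E₁ f := h.link_eq.symm
  have hl' : {e ∈ E₁ | lorentz e f = 0} = link E₁ f := rfl
  rw [hl] at h2
  rw [hl'] at h1
  rw [hint, h1, h2] at h0
  have hX := PowerSeries.mul_inv_cancel (1 + PowerSeries.X : ℚ⟦X⟧) (by simp)
  rw [glued, add_comm PowerSeries.X (1 : ℚ⟦X⟧)]
  linear_combination h0 - (rootGrowth (link E₁ f))⁻¹ * hX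

lemma isOrthogonalNormal_glued (h : IsMatching E₁ E₂ f) {f' : Mink d}
    (hf' : IsOrthogonalNormal E₁ f') (hff' : lorentz f' f ≤ -1) :
    IsOrthogonalNormal (glued E₁ E₂ f) f' := by
  have hne : f' ≠ f := by
    rintro rfl
    linarith [h.unit]
  refine ⟨Or.inl ⟨hf'.1, hne⟩, fun e he hef => ?_⟩
  rcases he with he | he
  · exact hf'.2 e he.1 hef
  rcases h.symm.mem_link_or he with ⟨-, he'⟩ | he'
  · exact hf'.2 e he'.1 hef
  · right
    rw [lorentz_comm]
    exact h.lorentz_le_neg_one hf'.1 he.1 hff' he'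

lemma link_glued (h : IsMatching E₁ E₂ f) {f' : Mink d}
    (hf' : IsOrthogonalNormal E₁ f') (hff' : lorentz f' f ≤ -1) :
    link (glued E₁ E₂ f) f' = link E₁ f' := by
  ext e
  constructor
  · rintro ⟨he | he, hef⟩
    · exact ⟨he.1, hef⟩
    · refine ⟨?_, hef⟩
      rcases h.symm.mem_link_or he with ⟨-, he'⟩ | he'
      · exact he'.1
      · have := h.lorentz_le_neg_one hf'.1 he.1 hff' he'
        rw [lorentz_comm, hef] at this
        linarith
  · rintro ⟨he, hef⟩
    refine ⟨Or.inl ⟨he, ?_⟩, hef⟩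
    rintro rfl
    rw [lorentz_comm] at hef
    linarith

lemma wall_glued (h : IsMatching E₁ E₂ f) {f' : Mink d}
    (hf' : IsOrthogonalNormal E₁ f') (hff' : lorentz f' f ≤ -1) :
    wall (glued E₁ E₂ f) f' = wall E₁ f' := by
  ext x
  constructor
  · rintro ⟨hx, hxf'⟩
    refine ⟨⟨hx.1, fun e he => ?_⟩, hxf'⟩
    by_cases hef : e = f
    · obtain ⟨p, hp⟩ := h.left.exists_mem_openCone
      have := lorentz_add_nonpos (h.left.unit f' hf'.1) h.unit hff' hp.1 (hp.2 f' hf'.1).le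
        (hp.2 f h.normal_left.1).le (hyperbolicSpace_subset_futureCone hx.1)
      rw [hef]
      linarith
    · exact hx.2 e (Or.inl ⟨he, hef⟩)
  · rintro ⟨hx, hxf'⟩
    refine ⟨?_, hxf'⟩
    rw [h.chamber_glued]
    exact Or.inl hx

end IsMatching

/-- Chambers which intersect in a common orthogonal facet match along this facet. -/
lemma isMatching_of_inter_eq_wall {f₁ f₂ : Mink d} (h₁ : IsRootBasis E₁) (h₂ : IsRootBasis E₂)
    (hf₁ : IsOrthogonalNormal E₁ f₁) (hf₂ : IsOrthogonalNormal E₂ f₂)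
    (hwall : wall E₁ f₁ = wall E₂ f₂) (hinter : chamber E₁ ∩ chamber E₂ = wall E₁ f₁) :
    f₂ = -f₁ ∧ IsMatching E₁ E₂ f₁ := by
  have hlink : link E₁ f₁ = link E₂ f₂ := by
    rw [← h₁.facetNormals_wall hf₁, hwall, h₂.facetNormals_wall hf₂]
  have hker : LinearMap.ker (lorentzDual f₁) = LinearMap.ker (lorentzDual f₂) := by
    rw [← h₁.span_wall hf₁, hwall, h₂.span_wall hf₂]
  obtain ⟨q, hq, hqf⟩ := h₁.exists_mem_wall hf₁.1
  have hu₁ := h₁.unit f₁ hf₁.1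
  have hu₂ := h₂.unit f₂ hf₂.1
  rcases eq_or_eq_neg_of_orthogonal (U := ⊤) Submodule.mem_top Submodule.mem_top hu₁ hu₂
    (by rw [top_inf_eq, hker]) (fun x hx => hx) hq.1 Submodule.mem_top hqf with h | h
  -- If both chambers were on the same side, an interior point of the common wall pushed inwards
  -- would lie in both of them but not in the wall.
  · exfalso
    subst h
    obtain ⟨p₁, hp₁⟩ := h₁.exists_mem_openCone
    obtain ⟨p₂, hp₂⟩ := h₂.exists_mem_openCone
    have hq₂ : q ∈ openCone (E₂ \ {f₂}) := by
      refine ⟨hq.1, fun e he => ?_⟩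
      rcases hf₂.2 e he.1 he.2 with h | h
      · have hl : e ∈ link E₁ f₂ := hlink ▸ ⟨he.1, h⟩
        exact hq.2 e ⟨hl.1, he.2⟩
      · have := lorentz_add_neg (h₂.unit e he.1) hu₂ h hp₂.1 (hp₂.2 e he.1) (hp₂.2 _ hf₂.1).le hq.1
        rwa [hqf, add_zero] at this
    have hq₃ : q ∈ openCone ((E₁ ∪ E₂) \ {f₂}) :=
      ⟨hq.1, fun e he => he.1.elim (fun h => hq.2 e ⟨h, he.2⟩) fun h => hq₂.2 e ⟨h, he.2⟩⟩
    obtain ⟨a, ha, hqa⟩ := exists_add_smul_mem_openCone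
      ((h₁.finite.union h₂.finite).subset Set.sdiff_subset) hq₃ (-f₂)
    have hneg : lorentz (q + a • -f₂) f₂ < 0 := by
      simp only [lorentz_add_left, hqf, lorentz_smul_left, lorentz_neg_left, hu₂]
      linarith
    obtain ⟨b, hb, hbq⟩ := exists_smul_mem_chamberIn (U := ⊤) (E := E₁ ∪ E₂) hqa.1
      Submodule.mem_top (fun e he => by
        by_cases hef : e = f₂
        · rw [hef]; exact hneg.le
        · exact (hqa.2 e ⟨he, hef⟩).le)
    have hw : b • (q + a • -f₂) ∈ wall E₁ f₂ := by
      rw [← hinter]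
      exact ⟨⟨hbq.1, fun e he => hbq.2.2 e (Or.inl he)⟩,
        ⟨hbq.1, fun e he => hbq.2.2 e (Or.inr he)⟩⟩
    have := hw.2
    rw [lorentz_smul_left] at this
    exact (mul_neg_of_pos_of_neg hb hneg).ne this
  · subst h
    exact ⟨rfl, h₁, h₂, hf₁, hf₂, hlink⟩

end Matching

/-! ### Isometric images -/

section Image

variable {d : ℕ} {E : Set (Mink d)} {g : Mink d ≃ₗ[ℝ] Mink d}

lemma IsRootBasis.image (hE : IsRootBasis E) (hg : IsHypIsometry g) : IsRootBasis (g '' E) where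
  finite := hE.finite.image g
  unit := by
    rintro _ ⟨e, he, rfl⟩
    rw [hg.1, hE.unit e he]
  pair := by
    rintro _ ⟨e, he, rfl⟩ _ ⟨f, hf, rfl⟩ hne
    rw [hg.1]
    exact hE.pair e he f hf fun h => hne (h ▸ rfl)
  interior := by
    obtain ⟨x, hx, h⟩ := hE.interior
    refine ⟨g x, hg.2 x hx, ?_⟩
    rintro _ ⟨e, he, rfl⟩
    rw [hg.1]
    exact h e he

lemma chamber_image (hg : IsHypIsometry g) (E : Set (Mink d)) :
    chamber (g '' E) = g '' chamber E := by
  ext x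
  obtain ⟨x, rfl⟩ := g.surjective x
  rw [g.injective.mem_set_image]
  simp only [chamber, Set.mem_ofPred_eq, Set.forall_mem_image, hg.1, hg.mem_iff]

lemma wall_image (hg : IsHypIsometry g) (E : Set (Mink d)) (f : Mink d) :
    wall (g '' E) (g f) = g '' wall E f := by
  ext x
  obtain ⟨x, rfl⟩ := g.surjective x
  rw [g.injective.mem_set_image]
  simp only [wall, Set.mem_ofPred_eq, chamber_image hg, g.injective.mem_set_image, hg.1]

lemma link_image (hg : IsHypIsometry g) (E : Set (Mink d)) (f : Mink d) :
    link (g '' E) (g f) = g '' link E f := by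
  ext x
  obtain ⟨x, rfl⟩ := g.surjective x
  rw [g.injective.mem_set_image]
  simp only [link, Set.mem_ofPred_eq, g.injective.mem_set_image, hg.1]

lemma IsOrthogonalNormal.image {f : Mink d} (hf : IsOrthogonalNormal E f)
    (hg : IsHypIsometry g) : IsOrthogonalNormal (g '' E) (g f) := by
  refine ⟨Set.mem_image_of_mem g hf.1, ?_⟩
  rintro _ ⟨e, he, rfl⟩ hne
  rw [hg.1]
  exact hf.2 e he fun h => hne (h ▸ rfl)

/-- Conjugation by `g` carries each reflection $r_e$ to $r_{ge}$. -/
lemma rootGrowth_image (hE : ∀ e ∈ E, lorentz e e = 1) (hg : IsHypIsometry g) :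
    rootGrowth (g '' E) = rootGrowth E := by
  have : reflections (g '' E) = MulAut.conj g '' reflections E := by
    rw [reflections, reflections, Set.image_image, Set.image_image]
    refine Set.image_congr fun e he => ?_
    rw [MulAut.conj_apply, eq_mul_inv_iff_mul_eq]
    ext1 x
    simp only [LinearEquiv.mul_apply]
    rw [lorentzReflection_apply (by rw [hg.1, hE e he]), lorentzReflection_apply (hE e he), hg.1,
      map_sub, map_smul]
  rw [rootGrowth, this, growthSeries_image_mulEquiv, rootGrowth]

end Image

/-! ### The truncated simplex -/

section Gram

/-- The inverse of `simplexGram`. -/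
def simplexInv : Matrix (Fin 5) (Fin 5) ℝ :=
  !![7/6 - 11/30 * √5, -2/3 + 2/15 * √5, -5/6 + 1/30 * √5, 1/3 - 7/15 * √5, -1/6 - 1/6 * √5;
     -2/3 + 2/15 * √5, 4/3 - 8/15 * √5, 1/3 - 7/15 * √5, -2/3 - 2/15 * √5, 1/3 - 1/3 * √5;
     -5/6 + 1/30 * √5, 1/3 - 7/15 * √5, 7/6 - 11/30 * √5, -2/3 + 2/15 * √5, -1/6 - 1/6 * √5;
     1/3 - 7/15 * √5, -2/3 - 2/15 * √5, -2/3 + 2/15 * √5, 4/3 - 8/15 * √5, 1/3 - 1/3 * √5;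
     -1/6 - 1/6 * √5, 1/3 - 1/3 * √5, -1/6 - 1/6 * √5, 1/3 - 1/3 * √5, 4/3 - 1/3 * √5]

lemma simplexGram_eq : simplexGram =
    !![1, -(1 + √5) / 4, 0, -1/2, 0;
       -(1 + √5) / 4, 1, -1/2, 0, -1/2;
       0, -1/2, 1, -(1 + √5) / 4, 0;
       -1/2, 0, -(1 + √5) / 4, 1, -1/2;
       0, -1/2, 0, -1/2, 1] := by
  ext i j
  fin_cases i <;> fin_cases j <;>
    simp [simplexGram, simplexOrder, neg_div, Real.cos_pi_div_five, Real.cos_pi_div_three] <;> ring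

lemma sqrt_five_bounds : √5 ^ 2 = (5 : ℝ) ∧ (2.236 : ℝ) < √5 ∧ √5 < (2.237 : ℝ) := by
  refine ⟨Real.sq_sqrt (by norm_num), ?_, ?_⟩
  · exact Real.lt_sqrt_of_sq_lt (by norm_num)
  · rw [Real.sqrt_lt' (by norm_num)]
    norm_num

lemma simplexGram_mul_simplexInv : simplexGram * simplexInv = 1 := by
  have hs := sqrt_five_bounds.1
  rw [simplexGram_eq, simplexInv]
  ext i j
  fin_cases i <;> fin_cases j <;>
    simp [Matrix.mul_apply, Fin.sum_univ_five] <;> ring_nf <;> rw [hs] <;> ring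

lemma det_simplexGram : simplexGram.det = -15/32 - 9/32 * √5 := by
  have hs := sqrt_five_bounds.1
  have hs4 : √5 ^ 4 = (25 : ℝ) := by
    rw [show √5 ^ 4 = (√5 ^ 2) ^ 2 by ring, hs]; norm_num
  rw [simplexGram_eq]
  simp [Matrix.det_succ_row_zero, Fin.sum_univ_succ, Fin.succAbove]
  ring_nf
  nlinarith

lemma det_simplexGram_neg : simplexGram.det < 0 := by
  rw [det_simplexGram]
  have := Real.sqrt_nonneg 5
  linarith

lemma adjugate_simplexGram (i j : Fin 5) :
    simplexGram.adjugate i j = simplexGram.det * simplexInv i j := by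
  have : simplexGram.adjugate = simplexGram.det • simplexInv := by
    calc simplexGram.adjugate = simplexGram.adjugate * (simplexGram * simplexInv) := by
          rw [simplexGram_mul_simplexInv, mul_one]
      _ = simplexGram.det • simplexInv := by
          rw [← mul_assoc, Matrix.adjugate_mul, Matrix.smul_mul, one_mul]
  rw [this, Matrix.smul_apply, smul_eq_mul]

lemma simplexInv_symm (i j : Fin 5) : simplexInv i j = simplexInv j i := by
  fin_cases i <;> fin_cases j <;> rfl

/-- These entries are the squares of the dual vectors. Positivity makes the vertices ultraideal; the
upper bound keeps each truncating hyperplane from meeting the facet opposite to its vertex. -/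
lemma simplexInv_diag (i : Fin 5) : 0 < simplexInv i i ∧ simplexInv i i ≤ 1 := by
  obtain ⟨-, h1, h2⟩ := sqrt_five_bounds
  fin_cases i <;> simp [simplexInv] <;> constructor <;> linarith

/-- After normalisation this says $v_i\circ v_j\le-1$: the truncating hyperplanes are pairwise
disjoint. -/
lemma simplexInv_off_diag {i j : Fin 5} (hij : i ≠ j) :
    simplexInv i j < 0 ∧ simplexInv i i * simplexInv j j ≤ simplexInv i j ^ 2 := by
  obtain ⟨hs, h1, h2⟩ := sqrt_five_bounds
  fin_cases i <;> fin_cases j <;> first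
    | exact absurd rfl hij
    | (simp only [simplexInv]; constructor <;> simp <;> nlinarith)

lemma simplexOrder_ge {i j : Fin 5} (hij : i ≠ j) : 2 ≤ simplexOrder i j := by
  fin_cases i <;> fin_cases j <;> first | exact absurd rfl hij | simp [simplexOrder]

/-- Coefficients of an interior point of the truncated simplex. -/
def interiorCoeff : Fin 5 → ℝ := ![1, 1, 1, 1, 1/2]

lemma interiorCoeff_pos (i : Fin 5) : 0 < interiorCoeff i := by
  fin_cases i <;> simp [interiorCoeff]

/-- With last coefficient $1$ instead of $1/2$ the last column would sum to $0$. -/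
lemma sum_interiorCoeff_neg (j : Fin 5) : ∑ k, interiorCoeff k * simplexGram k j < 0 := by
  obtain ⟨-, h1, h2⟩ := sqrt_five_bounds
  rw [simplexGram_eq]
  fin_cases j <;> simp [interiorCoeff, Fin.sum_univ_five] <;> linarith

/-- The symmetry of the Coxeter graph of the simplex. -/
def graphSymm : Equiv.Perm (Fin 5) := Equiv.swap 0 2 * Equiv.swap 1 3

lemma simplexOrder_graphSymm (i j : Fin 5) :
    simplexOrder (graphSymm i) (graphSymm j) = simplexOrder i j := by
  fin_cases i <;> fin_cases j <;> rfl

lemma interiorCoeff_graphSymm (i : Fin 5) : interiorCoeff (graphSymm i) = interiorCoeff i := by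
  have h : graphSymm 0 = 2 ∧ graphSymm 1 = 3 ∧ graphSymm 2 = 0 ∧ graphSymm 3 = 1 ∧
    graphSymm 4 = 4 := by decide
  obtain ⟨h0, h1, h2, h3, h4⟩ := h
  fin_cases i
  · exact (congrArg interiorCoeff h0).trans rfl
  · exact (congrArg interiorCoeff h1).trans rfl
  · exact (congrArg interiorCoeff h2).trans rfl
  · exact (congrArg interiorCoeff h3).trans rfl
  · exact (congrArg interiorCoeff h4).trans rfl

end Gram

/-! ### Outward normals of the truncated simplex -/

section Domino

lemma lorentz_sum_left {d : ℕ} {ι : Type} (s : Finset ι) (x : ι → Mink d) (y : Mink d) :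
    lorentz (∑ k ∈ s, x k) y = ∑ k ∈ s, lorentz (x k) y :=
  map_sum (lorentzDual y) x s

lemma lorentz_sum_right {d : ℕ} {ι : Type} (s : Finset ι) (x : ι → Mink d) (y : Mink d) :
    lorentz y (∑ k ∈ s, x k) = ∑ k ∈ s, lorentz y (x k) := by
  rw [lorentz_comm, lorentz_sum_left]
  simp only [lorentz_comm y]

variable {e : Fin 5 → Mink 4}

/-- The basis dual to the outward normals of the simplex. -/
def dualVector (e : Fin 5 → Mink 4) (i : Fin 5) : Mink 4 := ∑ k, simplexInv k i • e k

/-- The minus sign comes from $\det G<0$: the square root of $\mathrm{cof}_{ii}\det G$ contains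
$-\det G$. -/
lemma ultraidealVertex_eq (e : Fin 5 → Mink 4) (i : Fin 5) :
    ultraidealVertex e i = -(√(simplexInv i i))⁻¹ • dualVector e i := by
  have hd := det_simplexGram_neg
  have h : √(simplexGram.adjugate i i * simplexGram.det) =
      -simplexGram.det * √(simplexInv i i) := by
    rw [adjugate_simplexGram, show simplexGram.det * simplexInv i i * simplexGram.det =
      (-simplexGram.det) ^ 2 * simplexInv i i by ring, Real.sqrt_mul (sq_nonneg _),
      Real.sqrt_sq (by linarith)]
  rw [ultraidealVertex, h, dualVector]
  simp only [adjugate_simplexGram, mul_smul, ← Finset.smul_sum]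
  rw [smul_smul]
  congr 1
  have := hd.ne
  have := (Real.sqrt_pos.2 (simplexInv_diag i).1).ne'
  field_simp

/-- The outward normals of the truncated simplex. -/
def dominoNormals (e : Fin 5 → Mink 4) : Set (Mink 4) :=
  Set.range e ∪ Set.range (ultraidealVertex e)

lemma domino_eq_chamber (e : Fin 5 → Mink 4) : domino e = chamber (dominoNormals e) := by
  ext x
  constructor
  · rintro ⟨⟨hx, h1⟩, h2⟩
    refine ⟨hx, ?_⟩
    rintro _ (⟨i, rfl⟩ | ⟨i, rfl⟩)
    · exact h1 i
    · exact h2 i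
  · rintro ⟨hx, h⟩
    exact ⟨⟨hx, fun i => h _ (Or.inl ⟨i, rfl⟩)⟩, fun i => h _ (Or.inr ⟨i, rfl⟩)⟩

lemma orthogonalFacet_eq_wall (e : Fin 5 → Mink 4) (i : Fin 5) :
    orthogonalFacet e i = wall (dominoNormals e) (ultraidealVertex e i) := by
  rw [orthogonalFacet, wall, domino_eq_chamber]

namespace IsSimplexNormals

lemma lorentz_dualVector (he : IsSimplexNormals e) (i j : Fin 5) :
    lorentz (e j) (dualVector e i) = if j = i then 1 else 0 := by
  have := congrFun (congrFun simplexGram_mul_simplexInv j) i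
  rw [Matrix.mul_apply, Matrix.one_apply] at this
  rw [dualVector, lorentz_sum_right, ← this]
  refine Finset.sum_congr rfl fun k _ => ?_
  rw [lorentz_smul_right, he.1, mul_comm]

lemma lorentz_sum_dualVector (he : IsSimplexNormals e) (a : Fin 5 → ℝ) (i : Fin 5) :
    lorentz (∑ k, a k • e k) (dualVector e i) = a i := by
  rw [lorentz_sum_left]
  simp [he.lorentz_dualVector]

lemma lorentz_vertex (he : IsSimplexNormals e) (i j : Fin 5) :
    lorentz (e j) (ultraidealVertex e i) = if j = i then -(√(simplexInv i i))⁻¹ else 0 := by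
  rw [ultraidealVertex_eq, lorentz_smul_right, he.lorentz_dualVector]
  split_ifs <;> simp

lemma lorentz_vertex_ne (he : IsSimplexNormals e) {i j : Fin 5} (hij : j ≠ i) :
    lorentz (e j) (ultraidealVertex e i) = 0 := by
  rw [he.lorentz_vertex, if_neg hij]

lemma lorentz_vertex_self_le (he : IsSimplexNormals e) (i : Fin 5) :
    lorentz (e i) (ultraidealVertex e i) ≤ -1 := by
  rw [he.lorentz_vertex, if_pos rfl, neg_le_neg_iff]
  obtain ⟨h0, h1⟩ := simplexInv_diag i
  exact (one_le_inv₀ (Real.sqrt_pos.2 h0)).2 (Real.sqrt_le_one.2 h1)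

lemma lorentz_vertex_vertex (he : IsSimplexNormals e) (i j : Fin 5) :
    lorentz (ultraidealVertex e i) (ultraidealVertex e j) =
      (√(simplexInv i i) * √(simplexInv j j))⁻¹ * simplexInv i j := by
  rw [ultraidealVertex_eq, ultraidealVertex_eq, lorentz_smul_left, lorentz_smul_right,
    dualVector, he.lorentz_sum_dualVector, simplexInv_symm j i, mul_inv]
  ring

lemma lorentz_vertex_unit (he : IsSimplexNormals e) (i : Fin 5) :
    lorentz (ultraidealVertex e i) (ultraidealVertex e i) = 1 := by
  have h0 := (simplexInv_diag i).1
  rw [he.lorentz_vertex_vertex, Real.mul_self_sqrt h0.le, inv_mul_cancel₀ h0.ne']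

lemma lorentz_vertex_vertex_le (he : IsSimplexNormals e) {i j : Fin 5} (hij : i ≠ j) :
    lorentz (ultraidealVertex e i) (ultraidealVertex e j) ≤ -1 := by
  have hi := (simplexInv_diag i).1
  have hj := (simplexInv_diag j).1
  obtain ⟨h1, h2⟩ := simplexInv_off_diag hij
  have hpos := mul_pos (Real.sqrt_pos.2 hi) (Real.sqrt_pos.2 hj)
  rw [he.lorentz_vertex_vertex, inv_mul_le_iff₀ hpos, ← Real.sqrt_mul hi.le]
  have : √(simplexInv i i * simplexInv j j) ≤ -simplexInv i j :=
    Real.sqrt_le_iff.2 ⟨by linarith, by rwa [neg_sq]⟩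
  linarith

lemma lorentz_unit (he : IsSimplexNormals e) (i : Fin 5) : lorentz (e i) (e i) = 1 := by
  rw [he.1, simplexGram_eq]
  fin_cases i <;> simp

/-- An interior point of the cone over the truncated simplex. -/
lemma interior_mem_futureCone (he : IsSimplexNormals e) :
    ∑ k, interiorCoeff k • e k ∈ futureCone 4 := by
  have h1 : ∀ j, lorentz (∑ k, interiorCoeff k • e k) (e j) < 0 := fun j => by
    rw [lorentz_sum_left]
    simp only [lorentz_smul_left, he.1]
    exact sum_interiorCoeff_neg j
  have h2 : lorentz (∑ k, interiorCoeff k • e k) (∑ k, interiorCoeff k • e k) < 0 := by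
    rw [lorentz_sum_right]
    refine Finset.sum_neg (fun k _ => ?_) ⟨0, Finset.mem_univ _⟩
    rw [lorentz_smul_right]
    exact mul_neg_of_pos_of_neg (interiorCoeff_pos k) (h1 k)
  -- The Gram matrix does not distinguish the two sheets of the hyperboloid. A point `y` of the
  -- simplex does, and it fixes the time orientation.
  obtain ⟨U, -, ⟨y, hy⟩, hU⟩ := he.2.2
  have hyF := hyperbolicSpace_subset_futureCone hy.2
  have h3 : lorentz y (∑ k, interiorCoeff k • e k) ≤ 0 := by
    rw [lorentz_sum_right]
    refine Finset.sum_nonpos fun k _ => ?_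
    rw [lorentz_smul_right]
    exact mul_nonpos_of_nonneg_of_nonpos (interiorCoeff_pos k).le ((hU hy).2 k)
  refine mem_futureCone_of_lorentz_neg hyF h2 (lt_of_le_of_ne h3 fun h => ?_)
  rw [eq_zero_of_orthogonal hyF h2.le h] at h2
  simp at h2

lemma isRootBasis (he : IsSimplexNormals e) : IsRootBasis (dominoNormals e) where
  finite := (Set.finite_range _).union (Set.finite_range _)
  unit := by
    rintro _ (⟨i, rfl⟩ | ⟨i, rfl⟩)
    · exact he.lorentz_unit i
    · exact he.lorentz_vertex_unit i
  pair := by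
    have key : ∀ i j, (∃ m : ℕ, 2 ≤ m ∧
        lorentz (e j) (ultraidealVertex e i) = -Real.cos (Real.pi / m)) ∨
          lorentz (e j) (ultraidealVertex e i) ≤ -1 := by
      intro i j
      by_cases hij : j = i
      · exact Or.inr (hij ▸ he.lorentz_vertex_self_le j)
      · exact Or.inl ⟨2, le_rfl, by simp [he.lorentz_vertex_ne hij]⟩
    rintro _ (⟨i, rfl⟩ | ⟨i, rfl⟩) _ (⟨j, rfl⟩ | ⟨j, rfl⟩) hne
    · exact Or.inl ⟨simplexOrder i j, simplexOrder_ge fun h => hne (h ▸ rfl), he.1 i j⟩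
    · exact key j i
    · rw [lorentz_comm]
      exact key i j
    · exact Or.inr (he.lorentz_vertex_vertex_le fun h => hne (h ▸ rfl))
  interior := by
    obtain ⟨a, ha, hp⟩ := exists_smul_mem_hyperbolicSpace he.interior_mem_futureCone
    refine ⟨_, hp, ?_⟩
    rintro _ (⟨i, rfl⟩ | ⟨i, rfl⟩) <;> rw [lorentz_smul_left] <;>
      refine mul_neg_of_pos_of_neg ha ?_
    · rw [lorentz_sum_left]
      simp only [lorentz_smul_left, he.1]
      exact sum_interiorCoeff_neg i
    · rw [ultraidealVertex_eq, lorentz_smul_right, he.lorentz_sum_dualVector, neg_mul, neg_lt_zero]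
      exact mul_pos (inv_pos.2 (Real.sqrt_pos.2 (simplexInv_diag i).1)) (interiorCoeff_pos i)

lemma isOrthogonalNormal (he : IsSimplexNormals e) (i : Fin 5) :
    IsOrthogonalNormal (dominoNormals e) (ultraidealVertex e i) := by
  refine ⟨Or.inr ⟨i, rfl⟩, ?_⟩
  rintro _ (⟨j, rfl⟩ | ⟨j, rfl⟩) hne
  · by_cases hij : j = i
    · exact Or.inr (hij ▸ he.lorentz_vertex_self_le j)
    · exact Or.inl (he.lorentz_vertex_ne hij)
  · exact Or.inr (he.lorentz_vertex_vertex_le fun h => hne (h ▸ rfl))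

lemma link_vertex (he : IsSimplexNormals e) (i : Fin 5) :
    link (dominoNormals e) (ultraidealVertex e i) = e '' {j | j ≠ i} := by
  ext x
  constructor
  · rintro ⟨⟨j, rfl⟩ | ⟨j, rfl⟩, h⟩
    · refine ⟨j, ?_, rfl⟩
      rintro rfl
      have := he.lorentz_vertex_self_le j
      linarith
    · by_cases hij : j = i
      · rw [hij, he.lorentz_vertex_unit] at h
        exact absurd h one_ne_zero
      · have := he.lorentz_vertex_vertex_le hij
        linarith
  · rintro ⟨j, hj, rfl⟩
    exact ⟨Or.inl ⟨j, rfl⟩, he.lorentz_vertex_ne hj⟩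

lemma linearIndependent (he : IsSimplexNormals e) : LinearIndependent ℝ e := by
  rw [Fintype.linearIndependent_iff]
  intro a ha i
  rw [← he.lorentz_sum_dualVector a i, ha, lorentz_zero_left]

/-- The symmetry of the Coxeter graph is induced by an isometry. -/
lemma exists_isometry (he : IsSimplexNormals e) :
    ∃ g : Mink 4 ≃ₗ[ℝ] Mink 4, IsHypIsometry g ∧ ∀ i, g (e i) = e (graphSymm i) := by
  let b : Module.Basis (Fin 5) ℝ (Mink 4) :=
    basisOfLinearIndependentOfCardEqFinrank he.linearIndependent (by simp)
  have hb : ∀ i, b i = e i := fun i => by simp [b]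
  let g := b.equiv b graphSymm
  have hg : ∀ i, g (e i) = e (graphSymm i) := fun i => by
    rw [← hb, ← hb]
    exact b.equiv_apply i b graphSymm
  have hlor : ∀ x y, lorentz (g x) (g y) = lorentz x y := by
    intro x y
    rw [← b.sum_repr x, ← b.sum_repr y]
    simp only [map_sum, map_smul, lorentz_sum_left, lorentz_sum_right, lorentz_smul_left,
      lorentz_smul_right, hb, hg, he.1, simplexGram, Matrix.of_apply, simplexOrder_graphSymm]
  have hp := he.interior_mem_futureCone
  -- The coefficients are symmetric, so this timelike future vector is fixed; hence the isometry
  -- keeps the upper sheet.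
  have hgp : g (∑ k, interiorCoeff k • e k) = ∑ k, interiorCoeff k • e k := by
    simp only [map_sum, map_smul, hg]
    rw [← Equiv.sum_comp graphSymm fun k => interiorCoeff k • e k]
    simp only [interiorCoeff_graphSymm]
  refine ⟨g, ⟨hlor, fun x hx => ?_⟩, hg⟩
  rw [mem_hyperbolicSpace_iff, hlor]
  refine ⟨hx.1, mem_futureCone_of_lorentz_neg hp (by rw [hlor, hx.1]; norm_num) ?_⟩
  rw [← hgp, hlor]
  exact lorentz_neg_of_mem hp (hyperbolicSpace_subset_futureCone hx)

lemma rootGrowth_link_graphSymm (he : IsSimplexNormals e) (i : Fin 5) :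
    rootGrowth (link (dominoNormals e) (ultraidealVertex e (graphSymm i))) =
      rootGrowth (link (dominoNormals e) (ultraidealVertex e i)) := by
  obtain ⟨g, hg, hge⟩ := he.exists_isometry
  rw [← rootGrowth_image (E := link (dominoNormals e) (ultraidealVertex e i))
    (fun f hf => he.isRootBasis.unit f hf.1) hg, he.link_vertex, he.link_vertex]
  congr 1
  ext x
  constructor
  · rintro ⟨j, hj, rfl⟩
    refine ⟨e (graphSymm.symm j), ⟨_, fun h => hj ?_, rfl⟩, by rw [hge, Equiv.apply_symm_apply]⟩
    rw [← h, Equiv.apply_symm_apply]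
  · rintro ⟨_, ⟨j, hj, rfl⟩, rfl⟩
    exact ⟨graphSymm j, fun h => hj (graphSymm.injective h), (hge j).symm⟩

lemma polytopeGrowth_orthogonalFacet (he : IsSimplexNormals e) (i : Fin 5) :
    polytopeGrowth (orthogonalFacet e i) =
      rootGrowth (link (dominoNormals e) (ultraidealVertex e i)) := by
  rw [orthogonalFacet_eq_wall, he.isRootBasis.polytopeGrowth_wall (he.isOrthogonalNormal i)]

/-- Orthogonal facets of the same type have the same growth series. -/
lemma polytopeGrowth_orthogonalFacet_eq (he : IsSimplexNormals e) {i j : Fin 5}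
    (hij : facetType i = facetType j) :
    polytopeGrowth (orthogonalFacet e i) = polytopeGrowth (orthogonalFacet e j) := by
  have h : ∀ i j, facetType i = facetType j → i = j ∨ i = graphSymm j := by decide
  rcases h i j hij with rfl | rfl
  · rfl
  · rw [he.polytopeGrowth_orthogonalFacet, he.polytopeGrowth_orthogonalFacet,
      he.rootGrowth_link_graphSymm]

end IsSimplexNormals

end Domino

/-! ### Polytopes glued from copies of the truncated simplex -/

section Gluing

variable {e : Fin 5 → Mink 4} {P : Set (Mink 4)} {O : FacetType → Set (Set (Mink 4))} {N : ℕ}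
  {c : FacetType → ℕ}

/-- The contribution of the gluings to the inverse of the growth series. -/
def gluingTerm (γ : FacetType → ℚ⟦X⟧) (c : FacetType → ℕ) : ℚ⟦X⟧ :=
  (c FacetType.A : ℚ) • (γ FacetType.A)⁻¹ + (c FacetType.B : ℚ) • (γ FacetType.B)⁻¹ +
    (c FacetType.C : ℚ) • (γ FacetType.C)⁻¹

lemma gluingTerm_add (γ : FacetType → ℚ⟦X⟧) (c₁ c₂ : FacetType → ℕ) (X : FacetType) :
    gluingTerm γ (fun Y => c₁ Y + c₂ Y + if Y = X then 1 else 0) =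
      gluingTerm γ c₁ + gluingTerm γ c₂ + (γ X)⁻¹ := by
  cases X <;> simp [gluingTerm] <;> module

/-- The structure of a polytope `P` glued from `N` copies of `T`: it is a Coxeter polytope with
outward normals `E`, its free orthogonal facets lie in disjoint hyperplanes with outward normals
in `K`, and its growth series is determined by the numbers of gluings. -/
theorem IsGluing.exists_isRootBasis (he : IsSimplexNormals e) (γ : FacetType → ℚ⟦X⟧)
    (hγ : ∀ i, polytopeGrowth (orthogonalFacet e i) = γ (facetType i))
    (h : IsGluing e P O N c) : ∃ E K : Set (Mink 4), IsRootBasis E ∧ P = chamber E ∧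
      (∀ f ∈ K, IsOrthogonalNormal E f) ∧ (∀ f ∈ K, ∀ f' ∈ K, f ≠ f' → lorentz f f' ≤ -1) ∧
      (∀ Y, ∀ F ∈ O Y, ∃ f ∈ K, F = wall E f ∧ rootGrowth (link E f) = γ Y) ∧
      (rootGrowth E)⁻¹ = (N : ℚ) • (polytopeGrowth (domino e))⁻¹ +
        (PowerSeries.X - 1) * (PowerSeries.X + 1)⁻¹ * gluingTerm γ c := by
  induction h with
  | copy g hg =>
    have hE := he.isRootBasis
    refine ⟨g '' dominoNormals e, g '' Set.range (ultraidealVertex e), hE.image hg, ?_, ?_, ?_, ?_,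
      ?_⟩
    · rw [chamber_image hg, domino_eq_chamber]
    · rintro _ ⟨_, ⟨i, rfl⟩, rfl⟩
      exact (he.isOrthogonalNormal i).image hg
    · rintro _ ⟨_, ⟨i, rfl⟩, rfl⟩ _ ⟨_, ⟨j, rfl⟩, rfl⟩ hne
      rw [hg.1]
      exact he.lorentz_vertex_vertex_le fun h => hne (h ▸ rfl)
    · rintro Y F ⟨i, rfl, rfl⟩
      refine ⟨_, ⟨_, ⟨i, rfl⟩, rfl⟩, ?_, ?_⟩
      · rw [wall_image hg, orthogonalFacet_eq_wall]
      · rw [link_image hg, rootGrowth_image (fun f hf => hE.unit f hf.1) hg, ← hγ,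
          he.polytopeGrowth_orthogonalFacet]
    · rw [rootGrowth_image hE.unit hg, domino_eq_chamber, hE.polytopeGrowth_chamber]
      simp [gluingTerm]
  | glue P₁ P₂ O₁ O₂ N₁ N₂ c₁ c₂ X F h₁ h₂ hF₁ hF₂ hF ih₁ ih₂ =>
    obtain ⟨E₁, K₁, hE₁, rfl, hK₁, hKK₁, hO₁, hg₁⟩ := ih₁
    obtain ⟨E₂, K₂, hE₂, rfl, hK₂, hKK₂, hO₂, hg₂⟩ := ih₂
    obtain ⟨f, hf, rfl, hfγ⟩ := hO₁ X F hF₁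
    obtain ⟨f₂, hf₂, hw, -⟩ := hO₂ X _ hF₂
    obtain ⟨rfl, hm⟩ := isMatching_of_inter_eq_wall hE₁ hE₂ (hK₁ f hf) (hK₂ _ hf₂) hw hF
    -- the free orthogonal facets on one side are not affected by the gluing
    have key : ∀ {E₁ E₂ K : Set (Mink 4)} {f : Mink 4}, IsMatching E₁ E₂ f → f ∈ K →
        (∀ f ∈ K, IsOrthogonalNormal E₁ f) →
        (∀ f ∈ K, ∀ f' ∈ K, f ≠ f' → lorentz f f' ≤ -1) → ∀ f' ∈ K \ {f},
          IsOrthogonalNormal (glued E₁ E₂ f) f' ∧ link (glued E₁ E₂ f) f' = link E₁ f' ∧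
          wall (glued E₁ E₂ f) f' = wall E₁ f' := by
      intro E₁ E₂ K f hm hf hK hKK f' hf'
      have h1 := hKK f' hf'.1 f hf hf'.2
      exact ⟨hm.isOrthogonalNormal_glued (hK f' hf'.1) h1, hm.link_glued (hK f' hf'.1) h1,
        hm.wall_glued (hK f' hf'.1) h1⟩
    have k₁ := key hm hf hK₁ hKK₁
    have k₂ := key hm.symm hf₂ hK₂ hKK₂
    rw [glued_comm] at k₂
    -- Free facets from different sides are separated by the hyperplane of the gluing.
    have hcross : ∀ f₁ ∈ K₁ \ {f}, ∀ f₂ ∈ K₂ \ {-f}, lorentz f₁ f₂ ≤ -1 := fun f₁ h₁ f₂ h₂ =>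
      hm.lorentz_le_neg_one (hK₁ _ h₁.1).1 (hK₂ _ h₂.1).1 (hKK₁ _ h₁.1 f hf h₁.2)
        (hKK₂ _ h₂.1 _ hf₂ h₂.2)
    refine ⟨glued E₁ E₂ f, K₁ \ {f} ∪ K₂ \ {-f}, hm.isRootBasis, hm.chamber_glued.symm, ?_, ?_, ?_,
      ?_⟩
    · rintro f' (hf' | hf')
      · exact (k₁ f' hf').1
      · exact (k₂ f' hf').1
    · rintro f' (hf' | hf') f'' (hf'' | hf'') hne
      · exact hKK₁ f' hf'.1 f'' hf''.1 hne
      · exact hcross f' hf' f'' hf''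
      · rw [lorentz_comm]
        exact hcross f'' hf'' f' hf'
      · exact hKK₂ f' hf'.1 f'' hf''.1 hne
    · rintro Y F' ⟨hF' | hF', hne⟩
      · obtain ⟨f', hf', rfl, hγ'⟩ := hO₁ Y F' hF'
        have hf'K : f' ∈ K₁ \ {f} := ⟨hf', by rintro rfl; exact hne rfl⟩
        exact ⟨f', Or.inl hf'K, (k₁ f' hf'K).2.2.symm, by rw [(k₁ f' hf'K).2.1, hγ']⟩
      · obtain ⟨f', hf', rfl, hγ'⟩ := hO₂ Y F' hF'
        have hf'K : f' ∈ K₂ \ {-f} := ⟨hf', by rintro rfl; exact hne hw.symm⟩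
        exact ⟨f', Or.inr hf'K, (k₂ f' hf'K).2.2.symm, by rw [(k₂ f' hf'K).2.1, hγ']⟩
    · rw [hm.inv_rootGrowth_glued, hg₁, hg₂, hfγ, gluingTerm_add, Nat.cast_add, add_smul]
      ring

/-- Each copy has only one orthogonal facet of type `C`, which is glued at most once. -/
theorem IsGluing.ncard_add_le (h : IsGluing e P O N c) :
    (O FacetType.C).Finite ∧ (O FacetType.C).ncard + 2 * c FacetType.C ≤ N := by
  induction h with
  | copy g hg =>
    have hsub : {F | ∃ i, facetType i = FacetType.C ∧ F = g '' orthogonalFacet e i} ⊆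
        {g '' orthogonalFacet e 4} := by
      rintro F ⟨i, hi, rfl⟩
      have h4 : ∀ i, facetType i = FacetType.C → i = 4 := by decide
      rw [h4 i hi]
      rfl
    refine ⟨(Set.finite_singleton _).subset hsub, ?_⟩
    simpa using Set.ncard_le_ncard hsub
  | glue P₁ P₂ O₁ O₂ N₁ N₂ c₁ c₂ X F h₁ h₂ hF₁ hF₂ hF ih₁ ih₂ =>
    obtain ⟨f₁, ih₁⟩ := ih₁
    obtain ⟨f₂, ih₂⟩ := ih₂
    refine ⟨(f₁.union f₂).subset Set.sdiff_subset, ?_⟩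
    beta_reduce
    split_ifs with hX
    · subst hX
      -- `F` was free on both sides, so two free facets are lost for one gluing and the sum of free
      -- facets and twice the gluings stays bounded.
      have h0 : (O₁ FacetType.C ∪ O₂ FacetType.C) \ {F} =
          (O₁ FacetType.C \ {F}) ∪ (O₂ FacetType.C \ {F}) := Set.union_sdiff_distrib
      have h1 := Set.ncard_union_le (O₁ FacetType.C \ {F}) (O₂ FacetType.C \ {F})
      have h2 := Set.ncard_sdiff_singleton_add_one hF₁ f₁
      have h3 := Set.ncard_sdiff_singleton_add_one hF₂ f₂
      rw [h0]
      omega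
    · have h1 := Set.ncard_union_le (O₁ FacetType.C) (O₂ FacetType.C)
      have h2 := Set.ncard_le_ncard (Set.sdiff_subset (s := O₁ FacetType.C ∪ O₂ FacetType.C)
        (t := {F})) (f₁.union f₂)
      omega

end Gluing

end CoxeterDomino

end

/-! ### The theorem on glued polytopes -/

theorem mainTheorem4
    (e : Fin 5 → CoxeterDomino.Mink 4) (he : CoxeterDomino.IsSimplexNormals e)
    (n ℓ m : ℕ) (hℓm : ℓ + m ≤ n)
    (P : Set (CoxeterDomino.Mink 4))
    (O : CoxeterDomino.FacetType → Set (Set (CoxeterDomino.Mink 4)))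
    (c : CoxeterDomino.FacetType → ℕ)
    (hP : CoxeterDomino.IsGluing e P O (n + 1) c)
    (hA : c CoxeterDomino.FacetType.A = ℓ)
    (hB : c CoxeterDomino.FacetType.B = m)
    (hC : c CoxeterDomino.FacetType.C = n - ℓ - m) :
    CoxeterDomino.IsCoxeterPolytope P ∧
    (Odd n → (n : ℝ) - ℓ - m ≤ ((n : ℝ) + 1) / 2) ∧
    (Even n → (n : ℝ) - ℓ - m ≤ (n : ℝ) / 2) ∧
    ∀ iA iB iC : Fin 5,
      CoxeterDomino.facetType iA = CoxeterDomino.FacetType.A →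
      CoxeterDomino.facetType iB = CoxeterDomino.FacetType.B →
      CoxeterDomino.facetType iC = CoxeterDomino.FacetType.C →
      (CoxeterDomino.polytopeGrowth P)⁻¹ =
        ((n : ℚ) + 1) • (CoxeterDomino.polytopeGrowth (CoxeterDomino.domino e))⁻¹ +
          (PowerSeries.X - 1) * (PowerSeries.X + 1)⁻¹ *
            ((ℓ : ℚ) •
                (CoxeterDomino.polytopeGrowth (CoxeterDomino.orthogonalFacet e iA))⁻¹ +
              (m : ℚ) •
                (CoxeterDomino.polytopeGrowth (CoxeterDomino.orthogonalFacet e iB))⁻¹ +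
              ((n : ℚ) - ℓ - m) •
                (CoxeterDomino.polytopeGrowth (CoxeterDomino.orthogonalFacet e iC))⁻¹) := by
  have hI : 2 * c CoxeterDomino.FacetType.C ≤ n + 1 := by
    have := hP.ncard_add_le.2
    omega
  have hC' : (n : ℝ) - ℓ - m = c CoxeterDomino.FacetType.C := by
    rw [hC, Nat.sub_sub, Nat.cast_sub hℓm]
    push_cast
    ring
  refine ⟨?_, fun _ => ?_, fun hn => ?_, fun iA iB iC hiA hiB hiC => ?_⟩
  -- The indices $0$, $1$, $4$ represent the types $A$, $B$, $C$; any representatives would do.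
  · obtain ⟨E, -, hE, rfl, -⟩ := hP.exists_isRootBasis he
      (fun Y => CoxeterDomino.polytopeGrowth (CoxeterDomino.orthogonalFacet e
        (match Y with | .A => 0 | .B => 1 | .C => 4)))
      fun i => he.polytopeGrowth_orthogonalFacet_eq (by revert i; decide)
    exact hE.isCoxeterPolytope_chamber
  · rw [hC', le_div_iff₀ two_pos, mul_comm]
    exact_mod_cast hI
  · obtain ⟨k, rfl⟩ := hn
    rw [hC', le_div_iff₀ two_pos, mul_comm]
    -- For even $n$ the bound $n+1$ is odd, so the even left side is at most $n$.
    have : 2 * c CoxeterDomino.FacetType.C ≤ k + k := by omega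
    exact_mod_cast this
  · obtain ⟨E, -, hE, rfl, -, -, -, h⟩ := hP.exists_isRootBasis he
      (fun Y => CoxeterDomino.polytopeGrowth (CoxeterDomino.orthogonalFacet e
        (match Y with | .A => iA | .B => iB | .C => iC)))
      fun i => he.polytopeGrowth_orthogonalFacet_eq (by
        cases hi : CoxeterDomino.facetType i
        · exact hiA.symm
        · exact hiB.symm
        · exact hiC.symm)
    have hC'' : (n : ℚ) - ℓ - m = c CoxeterDomino.FacetType.C := by
      rw [hC, Nat.sub_sub, Nat.cast_sub hℓm]
      push_cast
      ring
    rw [hE.polytopeGrowth_chamber, h, hC'', ← hA, ← hB, CoxeterDomino.gluingTerm, Nat.cast_add,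
      Nat.cast_one]
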